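/- There is an absolute constant $C>0$ with the following property. Let $a>0$, $b\ge 0$, $\gamma>0$, let $E\subset\mathbb R$ be a measurable set with $|E\cap I|\ge\gamma a$ for every interval $I$ of length $a$, let $1\le p\le\infty$, and let $f\in L^p(\mathbb R)$ be such that the support of $\hat f$ is contained in an interval of length $b$, where $\hat f(\xi)=\int f(x)e^{-ix\xi}\,dx$ is understood in the sense of tempered distributions. Then $$\|f\|_{L^p(E)}\ \ge\ \left(\frac{\gamma}{C}\right)^{C(ab+1)}\|f\|_{L^p(\mathbb R)} .$$ This is sharp up to the value of the constant, as the following example with $a=1$ shows. There are absolute constants $c>0$ and $b_0$ such that for all $1\le p\le\infty$, $0<\gamma\le 1$ and $b\ge b_0$ the following holds. Let $E_\gamma$ be the $1$-periodic set with $$E_\gamma\cap\left[-\tfrac12,\tfrac12\right]=\left[-\tfrac12,-\tfrac12+\tfrac\gamma2\right]\cup\left[\tfrac12-\tfrac\gamma2,\tfrac12\right],$$ and let $f_b(x)=\left(\frac{\sin(2\pi x)}{x}\right)^{\lfloor b/4\pi\rfloor}$. Then $E_\gamma$ is measurable, $|E_\gamma\cap I|\ge\gamma$ for every interval $I$ of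 length $1$, $f_b\in L^p(\mathbb R)$, $f_b\neq0$, $\operatorname{supp}\widehat{f_b}\subset[-\frac b2,\frac b2]$, and $$\|f_b\|_{L^p(E_\gamma)}\ \le\ \left(\frac{\gamma}{c}\right)^{\frac{b}{4\pi}-1}\|f_b\|_{L^p(\mathbb R)} .$$ -/

import Mathlib

open Set MeasureTheory
open scoped ENNReal FourierTransform SchwartzMap

noncomputable section

/-- The support of the Fourier transform `f̂(ξ) = ∫ f(x) e^{-ixξ} dx` of a function `f ∈ L^p(ℝ)`,
`1 ≤ p ≤ ∞`, where `f̂` is understood in the sense of tempered distributions. Mathlib's Fourier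
transform `𝓕` has the kernel `e^{-2πixξ}`, so that `f̂(ξ) = (𝓕 f)(ξ / 2π)`, and the support
of `f̂` is the support of `𝓕 f` dilated by the factor `2π`. -/
def fourierSupport {p : ℝ≥0∞} [Fact (1 ≤ p)] (f : Lp ℂ p (volume : Measure ℝ)) : Set ℝ :=
  (fun ξ : ℝ => 2 * Real.pi * ξ) '' Distribution.dsupport (𝓕 (f : 𝓢'(ℝ, ℂ)) : 𝓢'(ℝ, ℂ))

/-- `E ⊆ ℝ` is (Lebesgue) measurable and `|E ∩ I| ≥ γ a` for every interval `I` of length `a`. -/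
def IsThick (a γ : ℝ) (E : Set ℝ) : Prop :=
  NullMeasurableSet E volume ∧
    ∀ x : ℝ, ENNReal.ofReal (γ * a) ≤ volume (E ∩ Icc x (x + a))

/-- The `1`-periodic set whose part in `[-1/2, 1/2]` is
`[-1/2, -1/2 + γ/2] ∪ [1/2 - γ/2, 1/2]` (for `0 ≤ γ ≤ 1`). -/
def exampleSet (γ : ℝ) : Set ℝ :=
  {x | ∃ k : ℤ, x + k ∈ Icc (-(1 / 2) : ℝ) (-(1 / 2) + γ / 2) ∪ Icc (1 / 2 - γ / 2) (1 / 2)}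

/-- The function `x ↦ (sin (2πx) / x) ^ ⌊b / 4π⌋`, with the continuous value at `x = 0`;
here `sin (2πx) / x = 2π sinc (2πx)`. -/
def exampleFun (b : ℝ) (x : ℝ) : ℂ :=
  (((2 * Real.pi * Real.sinc (2 * Real.pi * x)) ^ ⌊b / (4 * Real.pi)⌋₊ : ℝ) : ℂ)

end

/-!
The inequality is proved by a local argument on intervals of unit length, after a dilation which
makes `a = 1` and a modulation which centres the spectrum at `0`.

A function `f ∈ L^p` with spectrum in an interval of length `b` is reproduced by convolution with
a kernel `κ` whose Fourier transform is a smooth plateau equal to `1` near the spectrum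
(`ae_eq_integral_mul_comp_sub`; the distributional input is that a tempered distribution kills
every Schwartz function supported off its support, `temperedDistribution_apply_eq_zero`). The
kernel is entire and, in the strip `|Im z| ≤ 6`, at most `L / (1 + (Re z)²)` with
`L = exp (O(b + 1))` (`exists_norm_fourierLaplace_plateau_le`). So `f` is almost everywhere the
restriction of a function `F` that is holomorphic in `|Im z| < 5` and is bounded on the disc of
radius `5` about a real point `x` by the convolution of `|F|` with `Λ / (1 + t²)` at `x`, where
`Λ = 52 L` (`differentiableOn_integral_mul_kernel`, `enorm_integral_mul_kernel_le`).

By Young's inequality this mean has `L^q` norm at most `π Λ ‖F‖_q`. Hence the unit intervals `I` on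
which the integral of its `q`-th power exceeds `2 (πΛ)^q ∫_I |F|^q` carry at most half of
`∫ |F|^q`. On each of the other intervals there is a point `x` at which the mean, and with it `F` on the disc of radius
`5` about `x`, is at most `M = 2πΛ` times the maximum `|F(x₀)|` over the interval
(`setLIntegral_Ioc_le`). There a Remez-type estimate applies (`volume_le_of_norm_le_mul`): a real
set of measure larger than `m` near `x₀` contains `N + 1` points that are `m / N` apart, and if `F`
were smaller than `(m / 14)^N |F(x₀)| / 5` at all of them, then Lagrange interpolation at these
points, together with the maximum principle for the quotient of the remainder by `∏ (z - xᵢ)`, would bound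
`|F(x₀)|` by a quantity less than itself as soon as `2M ≤ 3^(N+1)`. This avoids counting zeros, and
some `N = O(b + 1)` is large enough. Taking `m = γ / 2` leaves a part of `E` of measure
at least `γ / 2` in the interval on which `F` is comparable to its maximum, and summing over the
intervals gives the inequality; for `p = ∞` one interval, on which the essential supremum is almost
attained, is enough.

For the example, `|sin 2πx| ≤ πγ` and `|x| ≥ 1/4` on `E_γ` when `γ ≤ 1/2`, whereas
`sin (2πx) / x ≥ 4` for `|x| ≤ 1/4`; comparing with the `L^p` norm of `1 / (1 + x²)` gives the
upper bound. The spectrum is computed by induction on the exponent: each factor `sin (2πx) / x` is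
an average of the characters `e^{2πixσ}`, `|σ| ≤ 1`, so it widens the spectrum by at most `1` in
Mathlib's normalization (`integral_fourier_mul_sinc_pow_eq_zero`).
-/

/-! ### Separated points and Lagrange interpolation -/

/-- A set of measure larger than `N δ` contains `N + 1` points with consecutive gaps at least `δ`:
pick a point near the infimum, discard what lies less than `δ` to its right, and repeat. -/
lemma exists_separated_of_lt_volume {δ : ℝ} (hδ : 0 < δ) (N : ℕ) (S : Set ℝ) (hb : BddBelow S)
    (hS : ENNReal.ofReal (N * δ) < volume S) :
    ∃ x : ℕ → ℝ, (∀ i ≤ N, x i ∈ S) ∧ ∀ i < N, x i + δ ≤ x (i + 1) := by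
  induction N generalizing S with
  | zero =>
    have hne : S.Nonempty := nonempty_of_measure_ne_zero (by
      have := hS; simp at this; exact this.ne')
    obtain ⟨y, hy⟩ := hne
    exact ⟨fun _ => y, fun _ _ => hy, by simp⟩
  | succ N ih =>
    have hne : S.Nonempty := nonempty_of_measure_ne_zero (lt_of_le_of_lt zero_le hS).ne'
    obtain ⟨r, hr0, hr1, hr2⟩ := ENNReal.lt_iff_exists_real_btwn.1 hS
    have hr1' : ((N + 1 : ℕ) : ℝ) * δ < r := by
      by_contra h
      exact absurd (ENNReal.ofReal_le_ofReal (not_lt.1 h)) (not_le.2 hr1)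
    push_cast at hr1'
    obtain ⟨x₀, hx₀, hx₀'⟩ := exists_lt_of_csInf_lt hne
      (show sInf S < sInf S + (r - (N + 1) * δ) by linarith)
    have hS' : ENNReal.ofReal (N * δ) < volume (S ∩ Ici (x₀ + δ)) := by
      by_contra h
      have hsub : S ⊆ Icc (sInf S) (x₀ + δ) ∪ S ∩ Ici (x₀ + δ) := by
        intro y hy
        rcases le_total y (x₀ + δ) with h1 | h1
        · exact Or.inl ⟨csInf_le hb hy, h1⟩
        · exact Or.inr ⟨hy, h1⟩
      have h2 : volume S ≤ ENNReal.ofReal (x₀ + δ - sInf S) + ENNReal.ofReal (N * δ) := by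
        refine (measure_mono hsub).trans ((measure_union_le _ _).trans ?_)
        rw [Real.volume_Icc]
        exact add_le_add le_rfl (not_lt.1 h)
      have h3 := csInf_le hb hx₀
      rw [← ENNReal.ofReal_add (by linarith) (by positivity)] at h2
      refine absurd (hr2.trans_le (h2.trans (ENNReal.ofReal_le_ofReal ?_))) (lt_irrefl _)
      nlinarith
    obtain ⟨x, hx, hx'⟩ := ih _ (hb.mono inter_subset_left) hS'
    refine ⟨fun i => Nat.casesOn i x₀ x, ?_, ?_⟩
    · rintro (_ | i) hi
      · exact hx₀
      · exact (hx i (by omega)).1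
    · rintro (_ | i) hi
      · exact (hx 0 (by omega)).2
      · exact hx' i (by omega)

lemma separated_le {δ : ℝ} {N : ℕ} {x : ℕ → ℝ} (hx : ∀ i < N, x i + δ ≤ x (i + 1))
    {i k : ℕ} (hk : i + k ≤ N) : x i + k * δ ≤ x (i + k) := by
  induction k with
  | zero => simp
  | succ k ih =>
    have h1 := ih (by omega)
    have h2 := hx (i + k) (by omega)
    rw [← add_assoc]
    push_cast
    linarith

lemma prod_erase_range {M : Type*} [CommMonoid M] (f : ℕ → M) {i N : ℕ} (hi : i ≤ N) :
    ∏ j ∈ (Finset.range (N + 1)).erase i, f j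
      = (∏ j ∈ Finset.range i, f (i - (j + 1))) * ∏ j ∈ Finset.range (N - i), f (i + (j + 1)) := by
  have h : (Finset.range (N + 1)).erase i = Finset.range i ∪ Finset.Ico (i + 1) (N + 1) := by
    ext j; simp; omega
  rw [h, Finset.prod_union, ← Finset.prod_range_reflect, Finset.prod_Ico_eq_prod_range]
  · congr 1
    · refine Finset.prod_congr rfl fun j _ => by congr 1; omega
    · rw [show N + 1 - (i + 1) = N - i by omega]
      refine Finset.prod_congr rfl fun j _ => by congr 1; omega
  · rw [Finset.disjoint_left]; intro j; simp; omega

/-- The denominators of the Lagrange basis polynomials at `δ`-separated nodes are at least those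
at equally spaced nodes. -/
lemma factorial_mul_le_prod_sub {δ : ℝ} (hδ : 0 < δ) {N : ℕ} {x : ℕ → ℝ}
    (hx : ∀ i < N, x i + δ ≤ x (i + 1)) {i : ℕ} (hi : i ≤ N) :
    δ ^ N * (i.factorial * (N - i).factorial : ℝ)
      ≤ ∏ j ∈ (Finset.range (N + 1)).erase i, |x i - x j| := by
  have key : ∀ n : ℕ, ∏ j ∈ Finset.range n, (((j + 1 : ℕ) : ℝ) * δ) = n.factorial * δ ^ n := by
    intro n
    rw [Finset.prod_mul_distrib, ← Nat.cast_prod, Finset.prod_range_add_one_eq_factorial]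
    simp
  rw [prod_erase_range _ hi]
  have h1 : (i.factorial * δ ^ i : ℝ) ≤ ∏ j ∈ Finset.range i, |x i - x (i - (j + 1))| := by
    rw [← key]
    refine Finset.prod_le_prod (fun j _ => by positivity) fun j hj => ?_
    have hj := Finset.mem_range.1 hj
    have := separated_le hx (i := i - (j + 1)) (k := j + 1) (by omega)
    rw [show i - (j + 1) + (j + 1) = i by omega] at this
    exact le_trans (by linarith) (le_abs_self _)
  have h2 : ((N - i).factorial * δ ^ (N - i) : ℝ)
      ≤ ∏ j ∈ Finset.range (N - i), |x i - x (i + (j + 1))| := by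
    rw [← key]
    refine Finset.prod_le_prod (fun j _ => by positivity) fun j hj => ?_
    have hj := Finset.mem_range.1 hj
    have := separated_le hx (i := i) (k := j + 1) (by omega)
    rw [abs_sub_comm]
    exact le_trans (by linarith) (le_abs_self _)
  calc _ = (i.factorial * δ ^ i : ℝ) * ((N - i).factorial * δ ^ (N - i)) := by
        rw [show δ ^ N = δ ^ i * δ ^ (N - i) by rw [← pow_add]; congr 1; omega]; ring
    _ ≤ _ := mul_le_mul h1 h2 (by positivity) (Finset.prod_nonneg fun _ _ => abs_nonneg _)

/-- At `N + 1` nodes with gaps at least `m / N`, the sum of the reciprocals of the Lagrange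
denominators is at most `(2N / m)^N / N!`, and `N^N / N!` grows only exponentially. -/
lemma sum_inv_prod_sub_le {m : ℝ} (hm : 0 < m) {N : ℕ} (hN : 1 ≤ N) {x : ℕ → ℝ}
    (hx : ∀ i < N, x i + m / N ≤ x (i + 1)) :
    ∑ i ∈ Finset.range (N + 1), (∏ j ∈ (Finset.range (N + 1)).erase i, |x i - x j|)⁻¹
      ≤ (8 / m) ^ N := by
  have hN' : (0 : ℝ) < N := by exact_mod_cast hN
  have h1 : ∀ i ∈ Finset.range (N + 1),
      (∏ j ∈ (Finset.range (N + 1)).erase i, |x i - x j|)⁻¹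
        ≤ (N / m) ^ N / N.factorial * N.choose i := by
    intro i hi
    have hi : i ≤ N := by have := Finset.mem_range.1 hi; omega
    have h := factorial_mul_le_prod_sub (by positivity) hx hi
    refine (inv_anti₀ (by positivity) h).trans (le_of_eq ?_)
    rw [Nat.cast_choose ℝ hi]
    have : (N.factorial : ℝ) ≠ 0 := by positivity
    have : (i.factorial : ℝ) ≠ 0 := by positivity
    have : ((N - i).factorial : ℝ) ≠ 0 := by positivity
    rw [div_pow, div_pow]
    field_simp
  refine (Finset.sum_le_sum h1).trans ?_
  rw [← Finset.mul_sum, ← Nat.cast_sum, Nat.sum_range_choose]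
  have h2 := Real.pow_div_factorial_le_exp (x := 2 * N) (by positivity) N
  have h3 : Real.exp (2 * N) ≤ 8 ^ N := by
    -- `e ^ 2 < 8`
    rw [mul_comm, Real.exp_nat_mul]
    refine pow_le_pow_left₀ (by positivity) ?_ _
    have := Real.exp_one_lt_d9
    rw [show (2 : ℝ) = 1 + 1 by norm_num, Real.exp_add]
    nlinarith [Real.exp_pos 1]
  calc _ = (2 * N) ^ N / N.factorial / m ^ N := by
        push_cast; rw [div_pow, mul_pow]; field_simp
    _ ≤ 8 ^ N / m ^ N := by gcongr; exact h2.trans h3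
    _ = _ := by rw [div_pow]

/-- A holomorphic function vanishing at finitely many points is divisible by the corresponding
product. -/
lemma exists_eq_prod_mul {ι : Type*} [DecidableEq ι] {U : Set ℂ} (hU : IsOpen U) (s : Finset ι)
    {v : ι → ℂ} (hv : InjOn v s) {f : ℂ → ℂ} (hf : DifferentiableOn ℂ f U)
    (hvU : ∀ i ∈ s, v i ∈ U) (h0 : ∀ i ∈ s, f (v i) = 0) :
    ∃ k : ℂ → ℂ, DifferentiableOn ℂ k U ∧ ∀ z, f z = (∏ i ∈ s, (z - v i)) * k z := by
  induction s using Finset.induction_on generalizing f with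
  | empty => exact ⟨f, hf, by simp⟩
  | insert a s ha ih =>
    have hfa : ∀ z, f z = (z - v a) * dslope f (v a) z := by
      intro z
      have := sub_smul_dslope f (v a) z
      rw [h0 a (by simp), sub_zero] at this
      rw [← this, smul_eq_mul]
    obtain ⟨k, hk, hk'⟩ := ih (f := dslope f (v a)) (hv.mono (by simp))
      ((Complex.differentiableOn_dslope (hU.mem_nhds (hvU a (by simp)))).2 hf)
      (fun i hi => hvU i (by simp [hi])) (fun i hi => by
        have h1 := hfa (v i)
        rw [h0 i (by simp [hi])] at h1
        have h2 : v i - v a ≠ 0 := by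
          rw [sub_ne_zero]
          intro h
          have := hv (by simp [hi]) (by simp) h
          exact ha (this ▸ hi)
        exact (mul_eq_zero.1 h1.symm).resolve_left h2)
    refine ⟨k, hk, fun z => ?_⟩
    rw [hfa, hk', Finset.prod_insert ha, mul_assoc]

lemma norm_eval_interpolate_le {N : ℕ} {v r : ℕ → ℂ} {ε D : ℝ} (hε : 0 ≤ ε)
    (hr : ∀ i ≤ N, ‖r i‖ ≤ ε) {z : ℂ} (hz : ∀ i ≤ N, ‖z - v i‖ ≤ D) :
    ‖(Lagrange.interpolate (Finset.range (N + 1)) v r).eval z‖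
      ≤ ε * D ^ N *
        ∑ i ∈ Finset.range (N + 1), (∏ j ∈ (Finset.range (N + 1)).erase i, ‖v i - v j‖)⁻¹ := by
  rw [Lagrange.interpolate_apply, Polynomial.eval_finsetSum, Finset.mul_sum]
  refine norm_sum_le_of_le _ fun i hi => ?_
  have hi' : i ≤ N := by have := Finset.mem_range.1 hi; omega
  rw [Polynomial.eval_mul, Polynomial.eval_C, norm_mul, mul_assoc]
  refine mul_le_mul (hr i hi') ?_ (norm_nonneg _) hε
  rw [Lagrange.basis, Polynomial.eval_prod, norm_prod, ← Finset.prod_inv_distrib]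
  have hcard : ((Finset.range (N + 1)).erase i).card = N := by
    rw [Finset.card_erase_of_mem hi]; simp
  have hD : D ^ N = ∏ j ∈ (Finset.range (N + 1)).erase i, D := by
    rw [Finset.prod_const, hcard]
  rw [hD, ← Finset.prod_mul_distrib]
  refine Finset.prod_le_prod (fun _ _ => norm_nonneg _) fun j hj => ?_
  have hj' : j ≤ N := by have := Finset.mem_range.1 (Finset.mem_of_mem_erase hj); omega
  simp only [Lagrange.basisDivisor, Polynomial.eval_mul, Polynomial.eval_C, Polynomial.eval_sub,
    Polynomial.eval_X, norm_mul, norm_inv]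
  rw [mul_comm]
  exact mul_le_mul_of_nonneg_right (hz j hj') (by positivity)

/-- A Remez-type inequality. If a holomorphic function `φ` is at most `M ‖φ x₀‖` on the disc of
radius `4` about `x₀`, then a set of real points within distance `1` of `x₀` at which
`‖φ‖ ≤ (m / 14)^N / 5 * ‖φ x₀‖` has measure at most `m`, provided that `2 M ≤ 3^(N+1)`. Otherwise
the set contains `N + 1` separated points; interpolate `φ` at them by a polynomial `P`, which is small, and
bound the quotient of `φ - P` by `∏ (z - xᵢ)` with the maximum principle: on the circle of radius
`4` each factor has modulus at least `3`, at `x₀` at most `1`. -/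
lemma volume_le_of_norm_le_mul {U : Set ℂ} (hU : IsOpen U) {φ : ℂ → ℂ}
    (hφ : DifferentiableOn ℂ φ U) {x₀ : ℝ} (hball : Metric.closedBall (x₀ : ℂ) 4 ⊆ U)
    {M : ℝ} (hM : ∀ z ∈ Metric.closedBall (x₀ : ℂ) 4, ‖φ z‖ ≤ M * ‖φ x₀‖) (hx₀ : φ x₀ ≠ 0)
    {N : ℕ} (hN : 1 ≤ N) (hMN : 2 * M ≤ 3 ^ (N + 1)) {m : ℝ} (hm : 0 < m) {S : Set ℝ}
    (hS : S ⊆ Icc (x₀ - 1) (x₀ + 1))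
    (hSφ : ∀ x ∈ S, ‖φ x‖ ≤ (m / 14) ^ N / 5 * ‖φ x₀‖) :
    volume S ≤ ENNReal.ofReal m := by
  by_contra hvol
  rw [not_le] at hvol
  have hN' : (0 : ℝ) < N := by exact_mod_cast hN
  obtain ⟨x, hxS, hx⟩ := exists_separated_of_lt_volume (δ := m / N) (by positivity) N S
    (bddBelow_Icc.mono hS) (by rwa [mul_div_cancel₀ _ hN'.ne'])
  set s := Finset.range (N + 1) with hs
  set v : ℕ → ℂ := fun i => (x i : ℂ) with hv
  set ε := (m / 14) ^ N / 5 * ‖φ x₀‖ with hε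
  set Q := ∑ i ∈ s, (∏ j ∈ s.erase i, ‖v i - v j‖)⁻¹ with hQ
  have hmem : ∀ i ∈ s, i ≤ N := fun i hi => by have := Finset.mem_range.1 hi; omega
  have hQle : Q ≤ (8 / m) ^ N := by
    have := sum_inv_prod_sub_le hm hN hx
    simpa only [hQ, hv, ← Complex.ofReal_sub, Complex.norm_real, Real.norm_eq_abs] using this
  have hQ0 : 0 ≤ Q :=
    Finset.sum_nonneg fun i _ => inv_nonneg.2 (Finset.prod_nonneg fun _ _ => norm_nonneg _)
  have hxI : ∀ i ≤ N, ‖(x₀ : ℂ) - v i‖ ≤ 1 := by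
    intro i hi
    have := hS (hxS i hi)
    rw [hv, ← Complex.ofReal_sub, Complex.norm_real, Real.norm_eq_abs, abs_le]
    exact ⟨by linarith [this.2], by linarith [this.1]⟩
  have hlt : ∀ i j, i < j → j ≤ N → x i < x j := by
    intro i j hij hj
    have := separated_le hx (i := i) (k := j - i) (by omega)
    rw [show i + (j - i) = j by omega] at this
    have h2 : (0 : ℝ) < ((j - i : ℕ) : ℝ) := by exact_mod_cast Nat.sub_pos_of_lt hij
    have : 0 < ((j - i : ℕ) : ℝ) * (m / N) := by positivity
    linarith
  have hinj : InjOn v s := by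
    intro i hi j hj hij
    have hij : x i = x j := by simpa [hv] using hij
    rcases lt_trichotomy i j with h | h | h
    · exact absurd hij (hlt i j h (hmem j hj)).ne
    · exact h
    · exact absurd hij (hlt j i h (hmem i hi)).ne'
  set P := Lagrange.interpolate s v (fun i => φ (v i)) with hP
  have hr : ∀ i ≤ N, ‖φ (v i)‖ ≤ ε := fun i hi => hSφ _ (hxS i hi)
  have hε0 : 0 ≤ ε := by positivity
  have hball1 : ∀ i ∈ s, v i ∈ U := by
    intro i hi
    apply hball
    rw [Metric.mem_closedBall, dist_comm, dist_eq_norm]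
    linarith [hxI i (hmem i hi)]
  obtain ⟨k, hk, hkeq⟩ := exists_eq_prod_mul hU s hinj (f := fun z => φ z - P.eval z)
    (hφ.sub P.differentiable.differentiableOn) hball1 (fun i hi => by
      simp only [hP]
      rw [Lagrange.eval_interpolate_at_node _ hinj hi, sub_self])
  have hk0 : ‖k x₀‖ ≤ (M * ‖φ x₀‖ + ε * 5 ^ N * Q) / 3 ^ (N + 1) := by
    refine Complex.norm_le_of_forall_mem_frontier_norm_le (U := Metric.ball (x₀ : ℂ) 4)
      Metric.isBounded_ball ?_ ?_ (subset_closure (Metric.mem_ball_self (by norm_num)))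
    · refine DifferentiableOn.diffContOnCl (hk.mono ?_)
      exact Metric.closure_ball_subset_closedBall.trans hball
    · intro z hz
      rw [frontier_ball _ (by norm_num), mem_sphere_iff_norm] at hz
      have h1 : (3 : ℝ) ^ (N + 1) ≤ ‖∏ i ∈ s, (z - v i)‖ := by
        rw [norm_prod, show (3 : ℝ) ^ (N + 1) = ∏ i ∈ s, 3 by simp [hs]]
        refine Finset.prod_le_prod (fun _ _ => by norm_num) fun i hi => ?_
        have h2 := hxI i (hmem i hi)
        have h3 := norm_sub_norm_le (z - x₀) (v i - x₀)
        rw [show z - x₀ - (v i - x₀) = z - v i by ring, norm_sub_rev (v i), hz] at h3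
        linarith
      have h4 : ‖φ z - P.eval z‖ ≤ M * ‖φ x₀‖ + ε * 5 ^ N * Q := by
        refine (norm_sub_le _ _).trans (add_le_add (hM z ?_) ?_)
        · rw [mem_closedBall_iff_norm, hz]
        · refine norm_eval_interpolate_le hε0 hr fun i hi => ?_
          have h3 := norm_add_le (z - x₀) (x₀ - v i)
          rw [sub_add_sub_cancel, hz] at h3
          linarith [hxI i hi]
      rw [le_div_iff₀ (by positivity)]
      have h5 : ‖∏ i ∈ s, (z - v i)‖ * ‖k z‖ = ‖φ z - P.eval z‖ := by
        rw [← norm_mul, ← hkeq]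
      rw [mul_comm]
      exact (mul_le_mul_of_nonneg_right h1 (norm_nonneg _)).trans (h5.le.trans h4)
  have hp1 : ‖∏ i ∈ s, ((x₀ : ℂ) - v i)‖ ≤ 1 := by
    rw [norm_prod]
    exact Finset.prod_le_one (fun _ _ => norm_nonneg _) fun i hi => hxI i (hmem i hi)
  have hP0 : ‖P.eval (x₀ : ℂ)‖ ≤ ε * Q := by
    have := norm_eval_interpolate_le hε0 hr hxI
    rwa [one_pow, mul_one] at this
  have hfin : ‖φ x₀‖ ≤ ε * Q + (M * ‖φ x₀‖ + ε * 5 ^ N * Q) / 3 ^ (N + 1) := by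
    have h1 : φ x₀ = P.eval (x₀ : ℂ) + (∏ i ∈ s, ((x₀ : ℂ) - v i)) * k x₀ := by
      rw [← hkeq]; ring
    calc ‖φ x₀‖ ≤ ‖P.eval (x₀ : ℂ)‖ + ‖(∏ i ∈ s, ((x₀ : ℂ) - v i))‖ * ‖k x₀‖ := by
          rw [← norm_mul]; conv_lhs => rw [h1]
          exact norm_add_le _ _
      _ ≤ _ := by
          refine add_le_add hP0 ?_
          calc _ ≤ 1 * ‖k x₀‖ := mul_le_mul_of_nonneg_right hp1 (norm_nonneg _)
            _ ≤ _ := by rw [one_mul]; exact hk0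
  have hφ0 : 0 < ‖φ x₀‖ := norm_pos_iff.2 hx₀
  -- the bound `ε Q ≤ (4/7)^N ‖φ x₀‖ / 5` beats the factor `(5/3)^N`
  have hεQ : ε * Q ≤ (4 / 7) ^ N / 5 * ‖φ x₀‖ := by
    calc ε * Q ≤ ε * (8 / m) ^ N := by gcongr
      _ = _ := by
        rw [hε, show (4 / 7 : ℝ) = m / 14 * (8 / m) by field_simp; norm_num, mul_pow]; ring
  have e1 : (4 / 7 : ℝ) ^ N ≤ 1 := pow_le_one₀ (by norm_num) (by norm_num)
  have e2 : (4 / 7 : ℝ) ^ N * 5 ^ N ≤ 3 ^ N := by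
    rw [← mul_pow]; exact pow_le_pow_left₀ (by norm_num) (by norm_num) _
  have e3 : M * ‖φ x₀‖ / 3 ^ (N + 1) ≤ ‖φ x₀‖ / 2 := by
    rw [div_le_div_iff₀ (by positivity) (by norm_num)]
    nlinarith
  have e4 : ε * 5 ^ N * Q / 3 ^ (N + 1) ≤ ‖φ x₀‖ / 15 := by
    rw [div_le_div_iff₀ (by positivity) (by norm_num), pow_succ]
    have : ε * 5 ^ N * Q ≤ ‖φ x₀‖ / 5 * 3 ^ N := by
      calc ε * 5 ^ N * Q = ε * Q * 5 ^ N := by ring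
        _ ≤ (4 / 7) ^ N / 5 * ‖φ x₀‖ * 5 ^ N := by gcongr
        _ = ‖φ x₀‖ / 5 * ((4 / 7) ^ N * 5 ^ N) := by ring
        _ ≤ _ := by gcongr
    nlinarith
  rw [add_div] at hfin
  nlinarith

/-! ### Thick sets and holomorphic functions in a strip -/

/-- The convolution of `‖f‖` with the Poisson-type weight `Λ / (1 + t ^ 2)`, with values
in `[0, ∞]`. -/
noncomputable def weightedMean (Λ : ℝ) (f : ℝ → ℂ) (x : ℝ) : ℝ≥0∞ :=
  ∫⁻ s, ‖f s‖ₑ * ENNReal.ofReal (Λ * (1 + (x - s) ^ 2)⁻¹)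

lemma one_add_add_sq_le (u v : ℝ) : 1 + (u + v) ^ 2 ≤ 2 * (1 + u ^ 2) * (1 + v ^ 2) := by
  nlinarith [sq_nonneg (u - v), mul_nonneg (sq_nonneg u) (sq_nonneg v)]

lemma measurable_weight (Λ : ℝ) :
    Measurable fun q : ℝ × ℝ => ENNReal.ofReal (Λ * (1 + (q.1 - q.2) ^ 2)⁻¹) := by
  fun_prop

lemma lintegral_weight_left {Λ : ℝ} (hΛ : 0 ≤ Λ) (x : ℝ) :
    ∫⁻ s, ENNReal.ofReal (Λ * (1 + (x - s) ^ 2)⁻¹) = ENNReal.ofReal (Real.pi * Λ) := by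
  rw [lintegral_sub_left_eq_self (μ := volume)
    (fun t : ℝ => ENNReal.ofReal (Λ * (1 + t ^ 2)⁻¹)) x,
    ← ofReal_integral_eq_lintegral_ofReal (integrable_inv_one_add_sq.const_mul Λ)
      (Filter.Eventually.of_forall fun t => by positivity),
    integral_const_mul, integral_univ_inv_one_add_sq, mul_comm]

lemma lintegral_weight_right {Λ : ℝ} (hΛ : 0 ≤ Λ) (s : ℝ) :
    ∫⁻ x, ENNReal.ofReal (Λ * (1 + (x - s) ^ 2)⁻¹) = ENNReal.ofReal (Real.pi * Λ) := by
  rw [← lintegral_weight_left hΛ s]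
  refine lintegral_congr fun x => ?_
  rw [← neg_sub, neg_sq]

lemma aemeasurable_weightedMean (Λ : ℝ) {f : ℝ → ℂ} (hf : AEStronglyMeasurable f volume) :
    AEMeasurable (weightedMean Λ f) volume := by
  refine AEMeasurable.lintegral_prod_right' (μ := volume) (ν := volume)
    (f := fun q : ℝ × ℝ => ‖f q.2‖ₑ * ENNReal.ofReal (Λ * (1 + (q.1 - q.2) ^ 2)⁻¹)) ?_
  exact (hf.comp_snd.enorm).mul (measurable_weight Λ).aemeasurable

/-- Young's inequality for the convolution with the weight `Λ / (1 + t ^ 2)`, whose integral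
is `π Λ`. -/
lemma lintegral_weightedMean_rpow_le {Λ : ℝ} (hΛ : 0 ≤ Λ) {f : ℝ → ℂ}
    (hf : AEStronglyMeasurable f volume) {q : ℝ} (hq : 1 ≤ q) :
    ∫⁻ x, weightedMean Λ f x ^ q
      ≤ ENNReal.ofReal (Real.pi * Λ) ^ q * ∫⁻ x, ‖f x‖ₑ ^ q := by
  set A := ENNReal.ofReal (Real.pi * Λ) with hA
  have hq0 : 0 < q := by linarith
  have key : ∀ x, weightedMean Λ f x ^ q
      ≤ (∫⁻ s, ‖f s‖ₑ ^ q * ENNReal.ofReal (Λ * (1 + (x - s) ^ 2)⁻¹)) * A ^ (q - 1) := by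
    intro x
    set ρ : ℝ → ℝ≥0∞ := fun s => ENNReal.ofReal (Λ * (1 + (x - s) ^ 2)⁻¹) with hρ
    have hρm : Measurable ρ := by fun_prop
    set ν := volume.withDensity ρ with hν
    have hint : ∀ h : ℝ → ℝ≥0∞, ∫⁻ s, h s ∂ν = ∫⁻ s, h s * ρ s := by
      intro h
      rw [hν, lintegral_withDensity_eq_lintegral_mul_non_measurable _ hρm
        (Filter.Eventually.of_forall fun _ => ENNReal.ofReal_lt_top)]
      simp [mul_comm]
    have huniv : ν univ = A := by
      rw [hν, withDensity_apply _ MeasurableSet.univ, setLIntegral_univ, hρ,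
        lintegral_weight_left hΛ]
    have h1 := eLpNorm'_le_eLpNorm'_mul_rpow_measure_univ (f := f) (μ := ν) one_pos hq
      (hf.mono_ac (withDensity_absolutelyContinuous _ _))
    rw [eLpNorm'_eq_lintegral_enorm, eLpNorm'_eq_lintegral_enorm, huniv] at h1
    simp only [ENNReal.rpow_one, div_one, hint] at h1
    have h2 := ENNReal.rpow_le_rpow h1 hq0.le
    rw [ENNReal.mul_rpow_of_nonneg _ _ hq0.le, ← ENNReal.rpow_mul, ← ENNReal.rpow_mul,
      one_div_mul_cancel hq0.ne', ENNReal.rpow_one, sub_mul, one_div_mul_cancel hq0.ne',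
      one_mul] at h2
    exact h2
  refine (lintegral_mono key).trans ?_
  rw [lintegral_mul_const' _ _ (ENNReal.rpow_ne_top_of_nonneg (by linarith) ENNReal.ofReal_ne_top),
    lintegral_lintegral_swap]
  · have : ∀ s, ∫⁻ x, ‖f s‖ₑ ^ q * ENNReal.ofReal (Λ * (1 + (x - s) ^ 2)⁻¹) = ‖f s‖ₑ ^ q * A := by
      intro s
      rw [lintegral_const_mul' _ _ (ENNReal.rpow_ne_top_of_nonneg hq0.le enorm_ne_top),
        lintegral_weight_right hΛ]
    simp_rw [this]
    rw [lintegral_mul_const' _ _ ENNReal.ofReal_ne_top, mul_assoc, mul_comm]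
    gcongr
    refine le_of_eq ?_
    calc A * A ^ (q - 1) = A ^ (1 : ℝ) * A ^ (q - 1) := by rw [ENNReal.rpow_one]
      _ = A ^ q := by
        rw [← ENNReal.rpow_add_of_nonneg _ _ zero_le_one (by linarith)]; congr 1; ring
  · exact ((hf.comp_snd.enorm).pow_const q).mul (measurable_weight Λ).aemeasurable

lemma weightedMean_le_mul_eLpNorm_top {Λ : ℝ} (hΛ : 0 ≤ Λ) (f : ℝ → ℂ) (x : ℝ) :
    weightedMean Λ f x ≤ eLpNorm f ∞ volume * ENNReal.ofReal (Real.pi * Λ) := by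
  rw [weightedMean, ← lintegral_weight_left hΛ x, eLpNorm_exponent_top,
    ← lintegral_const_mul _ (by fun_prop)]
  refine lintegral_mono_ae ?_
  filter_upwards [enorm_ae_le_eLpNormEssSup f volume] with s hs
  gcongr

/-- If `F` is, near an interval of length `1`, at most `M` times its maximum on the interval,
then on a definite part of a thick set `E` it is not much smaller than that maximum. -/
lemma le_volume_setOf_lt_norm {F : ℂ → ℂ} (hF : DifferentiableOn ℂ F {z | |z.im| < 5})
    {γ : ℝ} (hγ : 0 < γ) {E : Set ℝ} (hE : IsThick 1 γ E) {k x x₀ M : ℝ}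
    (hx : x ∈ Icc k (k + 1)) (hx₀ : x₀ ∈ Icc k (k + 1))
    (hM : ∀ z ∈ Metric.closedBall (x : ℂ) 5, ‖F z‖ ≤ M * ‖F x₀‖) (h0 : F x₀ ≠ 0)
    {N : ℕ} (hN : 1 ≤ N) (hMN : 2 * M ≤ 3 ^ (N + 1)) :
    ENNReal.ofReal (γ / 2)
      ≤ volume (E ∩ Ioc k (k + 1) ∩ {t | (γ / 28) ^ N / 5 * ‖F x₀‖ < ‖F t‖}) := by
  have hxx₀ : dist (x₀ : ℂ) x ≤ 1 := by
    rw [dist_eq_norm, ← Complex.ofReal_sub, Complex.norm_real, Real.norm_eq_abs, abs_le]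
    exact ⟨by linarith [hx.2, hx₀.1], by linarith [hx.1, hx₀.2]⟩
  have hU : IsOpen {z : ℂ | |z.im| < 5} :=
    isOpen_lt (continuous_abs.comp Complex.continuous_im) continuous_const
  have hball : Metric.closedBall (x₀ : ℂ) 4 ⊆ {z | |z.im| < 5} := by
    intro z hz
    have h1 := Complex.abs_im_le_norm (z - x₀)
    rw [mem_closedBall_iff_norm] at hz
    simp only [Complex.sub_im, Complex.ofReal_im, sub_zero] at h1
    change |z.im| < 5
    linarith
  set S := Icc k (k + 1) ∩ {t : ℝ | ‖F t‖ ≤ (γ / 28) ^ N / 5 * ‖F x₀‖} with hS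
  have hSv : volume S ≤ ENNReal.ofReal (γ / 2) := by
    refine volume_le_of_norm_le_mul hU hF hball (M := M) (fun z hz => hM z ?_) h0 hN hMN
      (half_pos hγ) ?_ ?_
    · exact Metric.closedBall_subset_closedBall' (by linarith) hz
    · intro t ht
      exact ⟨by linarith [ht.1.1, hx₀.2], by linarith [ht.1.2, hx₀.1]⟩
    · intro t ht
      rw [show γ / 2 / 14 = γ / 28 by ring]
      exact ht.2
  have hsub : E ∩ Icc k (k + 1)
      ⊆ (E ∩ Ioc k (k + 1) ∩ {t | (γ / 28) ^ N / 5 * ‖F x₀‖ < ‖F t‖}) ∪ S ∪ {k} := by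
    rintro t ⟨htE, ht⟩
    rcases eq_or_lt_of_le ht.1 with h | h
    · exact Or.inr h.symm
    · left
      rcases lt_or_ge ((γ / 28) ^ N / 5 * ‖F x₀‖) ‖F t‖ with h' | h'
      · exact Or.inl ⟨⟨htE, h, ht.2⟩, h'⟩
      · exact Or.inr ⟨ht, h'⟩
  have h1 := hE.2 k
  rw [mul_one] at h1
  have h2 := h1.trans ((measure_mono hsub).trans ((measure_union_le _ _).trans
    (add_le_add_left (measure_union_le _ _) _)))
  rw [Real.volume_singleton, add_zero] at h2
  have h3 : ENNReal.ofReal γ = ENNReal.ofReal (γ / 2) + ENNReal.ofReal (γ / 2) := by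
    rw [← ENNReal.ofReal_add (by positivity) (by positivity), add_halves]
  rw [h3] at h2
  exact (ENNReal.add_le_add_iff_right ENNReal.ofReal_ne_top).1 (h2.trans (by gcongr))

lemma continuous_ofReal_of_differentiableOn_strip {F : ℂ → ℂ}
    (hF : DifferentiableOn ℂ F {z | |z.im| < 5}) : Continuous fun t : ℝ => F t :=
  hF.continuousOn.comp_continuous Complex.continuous_ofReal (by simp)

lemma exists_norm_le_on_unit_Icc {F : ℂ → ℂ}
    (hF : DifferentiableOn ℂ F {z | |z.im| < 5}) (k : ℝ) :
    ∃ x₀ ∈ Icc k (k + 1), ∀ t ∈ Icc k (k + 1), ‖F (t : ℝ)‖ ≤ ‖F (x₀ : ℝ)‖ :=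
  isCompact_Icc.exists_isMaxOn (nonempty_Icc.2 (by linarith))
    (continuous_ofReal_of_differentiableOn_strip hF).norm.continuousOn

/-- On a unit interval, either `∫ |F|^q` is dominated by a small multiple of the integral of
`(weightedMean Λ F)^q`, or `F` is under control near the interval and the thick set `E` captures a
definite part of `∫ |F|^q`. -/
lemma setLIntegral_Ioc_le {F : ℂ → ℂ} (hF : DifferentiableOn ℂ F {z | |z.im| < 5}) {Λ : ℝ}
    (hΛ : 0 < Λ)
    (hFΛ : ∀ x : ℝ, ∀ z ∈ Metric.closedBall (x : ℂ) 5, ‖F z‖ₑ ≤ weightedMean Λ (fun t => F t) x)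
    {γ : ℝ} (hγ : 0 < γ) {E : Set ℝ} (hE : IsThick 1 γ E) {N : ℕ} (hN : 1 ≤ N)
    (hΛN : 4 * (Real.pi * Λ) ≤ 3 ^ (N + 1)) {q : ℝ} (hq : 1 ≤ q) (k : ℝ) :
    ∫⁻ t in Ioc k (k + 1), ‖F (t : ℝ)‖ₑ ^ q
      ≤ (2 * ENNReal.ofReal (Real.pi * Λ) ^ q)⁻¹ *
          (∫⁻ x in Ioc k (k + 1), weightedMean Λ (fun t => F t) x ^ q)
        + (ENNReal.ofReal ((γ / 28) ^ N / 5) ^ q * ENNReal.ofReal (γ / 2))⁻¹ *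
          ∫⁻ t in Ioc k (k + 1) ∩ E, ‖F (t : ℝ)‖ₑ ^ q := by
  set A := ENNReal.ofReal (Real.pi * Λ) with hA
  have hq0 : 0 < q := by linarith
  have hcont := continuous_ofReal_of_differentiableOn_strip hF
  have hA0 : A ≠ 0 := by
    rw [hA, Ne, ENNReal.ofReal_eq_zero, not_le]; exact mul_pos Real.pi_pos hΛ
  have hAt : A ≠ ∞ := ENNReal.ofReal_ne_top
  have hAq0 : 2 * A ^ q ≠ 0 := mul_ne_zero two_ne_zero (by
    rw [Ne, ENNReal.rpow_eq_zero_iff_of_pos hq0]; exact hA0)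
  have hAqt : 2 * A ^ q ≠ ∞ := ENNReal.mul_ne_top ENNReal.ofNat_ne_top
    (ENNReal.rpow_ne_top_of_nonneg hq0.le hAt)
  by_cases h : ∫⁻ t in Ioc k (k + 1), ‖F (t : ℝ)‖ₑ ^ q
      ≤ (2 * A ^ q)⁻¹ * ∫⁻ x in Ioc k (k + 1), weightedMean Λ (fun t => F t) x ^ q
  · exact h.trans le_self_add
  rw [not_le] at h
  obtain ⟨x₀, hx₀, hmax⟩ := exists_norm_le_on_unit_Icc hF k
  have hvol : volume (Ioc k (k + 1)) = 1 := by rw [Real.volume_Ioc]; simp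
  have hle : ∫⁻ t in Ioc k (k + 1), ‖F (t : ℝ)‖ₑ ^ q ≤ ‖F (x₀ : ℝ)‖ₑ ^ q := by
    calc _ ≤ ∫⁻ t in Ioc k (k + 1), ‖F (x₀ : ℝ)‖ₑ ^ q := by
          refine setLIntegral_mono measurable_const fun t ht => ?_
          refine ENNReal.rpow_le_rpow ?_ hq0.le
          exact enorm_le_iff_norm_le.2 (hmax t (Ioc_subset_Icc_self ht))
      _ = _ := by rw [setLIntegral_const, hvol, mul_one]
  -- a point at which the weighted mean is at most its average over the interval
  obtain ⟨x, hx, hxle⟩ := exists_le_setLAverage (μ := volume) (s := Ioc k (k + 1))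
    (f := fun x => weightedMean Λ (fun t => F t) x ^ q) (by rw [hvol]; simp) (by rw [hvol]; simp)
    (((aemeasurable_weightedMean Λ hcont.aestronglyMeasurable).pow_const q).restrict)
  rw [setLAverage_eq, hvol, div_one] at hxle
  have hW : weightedMean Λ (fun t => F t) x ≤ 2 * A * ‖F (x₀ : ℝ)‖ₑ := by
    rw [← ENNReal.rpow_le_rpow_iff hq0]
    calc _ ≤ (2 * A ^ q) * ‖F (x₀ : ℝ)‖ₑ ^ q := by
          refine hxle.trans ?_
          rw [← ENNReal.inv_mul_le_iff hAq0 hAqt]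
          exact h.le.trans hle
      _ ≤ (2 ^ q * A ^ q) * ‖F (x₀ : ℝ)‖ₑ ^ q := by
          gcongr
          conv_lhs => rw [← ENNReal.rpow_one 2]
          exact ENNReal.rpow_le_rpow_of_exponent_le (by norm_num) hq
      _ = _ := by rw [ENNReal.mul_rpow_of_nonneg _ _ hq0.le, ENNReal.mul_rpow_of_nonneg _ _ hq0.le]
  have h0 : F x₀ ≠ 0 := by
    intro h0
    rw [h0, enorm_zero, ENNReal.zero_rpow_of_pos hq0] at hle
    exact absurd h (not_lt.2 (hle.trans zero_le))
  have hM : ∀ z ∈ Metric.closedBall (x : ℂ) 5, ‖F z‖ ≤ (2 * (Real.pi * Λ)) * ‖F x₀‖ := by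
    intro z hz
    have h1 := (hFΛ x z hz).trans hW
    have hpos : 0 ≤ Real.pi * Λ := (mul_pos Real.pi_pos hΛ).le
    rw [hA, ← ofReal_norm, ← ofReal_norm, ← ENNReal.ofReal_ofNat, ← ENNReal.ofReal_mul (by norm_num),
      ← ENNReal.ofReal_mul (by positivity), ENNReal.ofReal_le_ofReal_iff (by positivity)] at h1
    simpa using h1
  have hvolG := le_volume_setOf_lt_norm hF hγ hE (Ioc_subset_Icc_self hx) hx₀ hM h0 hN
    (by linarith)
  refine le_trans ?_ le_add_self
  set ε := (γ / 28) ^ N / 5 with hε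
  have hε0 : 0 < ε := by positivity
  set G := E ∩ Ioc k (k + 1) ∩ {t | ε * ‖F x₀‖ < ‖F (t : ℝ)‖} with hG
  have hK0 : ENNReal.ofReal ε ^ q * ENNReal.ofReal (γ / 2) ≠ 0 := by
    refine mul_ne_zero ?_ (by simpa using hγ)
    rw [Ne, ENNReal.rpow_eq_zero_iff_of_pos hq0]; simpa using hε0
  have hKt : ENNReal.ofReal ε ^ q * ENNReal.ofReal (γ / 2) ≠ ∞ :=
    ENNReal.mul_ne_top (ENNReal.rpow_ne_top_of_nonneg hq0.le ENNReal.ofReal_ne_top)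
      ENNReal.ofReal_ne_top
  rw [← ENNReal.mul_le_iff_le_inv hK0 hKt]
  calc _ ≤ ENNReal.ofReal ε ^ q * ENNReal.ofReal (γ / 2) * ‖F (x₀ : ℝ)‖ₑ ^ q := by gcongr
    _ = (ENNReal.ofReal ε * ‖F (x₀ : ℝ)‖ₑ) ^ q * ENNReal.ofReal (γ / 2) := by
        rw [ENNReal.mul_rpow_of_nonneg _ _ hq0.le]; ring
    _ ≤ (ENNReal.ofReal ε * ‖F (x₀ : ℝ)‖ₑ) ^ q * volume G := by gcongr
    _ = ∫⁻ t in G, (ENNReal.ofReal ε * ‖F (x₀ : ℝ)‖ₑ) ^ q := by rw [setLIntegral_const]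
    _ ≤ ∫⁻ t in G, ‖F (t : ℝ)‖ₑ ^ q := by
        refine setLIntegral_mono (hcont.measurable.enorm.pow_const q) fun t ht => ?_
        refine ENNReal.rpow_le_rpow ?_ hq0.le
        rw [← ofReal_norm, ← ofReal_norm, ← ENNReal.ofReal_mul hε0.le]
        exact ENNReal.ofReal_le_ofReal (le_of_lt ht.2)
    _ ≤ _ := by
        refine lintegral_mono_set ?_
        exact fun t ht => ⟨ht.1.2, ht.1.1⟩

lemma lintegral_eq_tsum_setLIntegral_Ioc (f : ℝ → ℝ≥0∞) :
    ∫⁻ t, f t = ∑' k : ℤ, ∫⁻ t in Ioc (k : ℝ) (k + 1), f t := by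
  rw [← lintegral_iUnion (fun _ => measurableSet_Ioc) (pairwise_disjoint_Ioc_intCast ℝ),
    iUnion_Ioc_intCast, setLIntegral_univ]

lemma setLIntegral_eq_tsum_Ioc_inter (E : Set ℝ) (f : ℝ → ℝ≥0∞) :
    ∫⁻ t in E, f t = ∑' k : ℤ, ∫⁻ t in Ioc (k : ℝ) (k + 1) ∩ E, f t := by
  have h := lintegral_iUnion (μ := volume.restrict E) (s := fun k : ℤ => Ioc (k : ℝ) (k + 1))
    (fun _ => measurableSet_Ioc) (pairwise_disjoint_Ioc_intCast ℝ) f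
  rw [iUnion_Ioc_intCast, setLIntegral_univ] at h
  simp_rw [Measure.restrict_restrict measurableSet_Ioc] at h
  exact h

/-- Sum `setLIntegral_Ioc_le` over the unit intervals. By Young's inequality the first terms add up
to at most half of the left-hand side, which is absorbed because it is finite. -/
lemma lintegral_rpow_le {F : ℂ → ℂ} (hF : DifferentiableOn ℂ F {z | |z.im| < 5}) {Λ : ℝ}
    (hΛ : 0 < Λ)
    (hFΛ : ∀ x : ℝ, ∀ z ∈ Metric.closedBall (x : ℂ) 5, ‖F z‖ₑ ≤ weightedMean Λ (fun t => F t) x)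
    {γ : ℝ} (hγ : 0 < γ) {E : Set ℝ} (hE : IsThick 1 γ E) {N : ℕ} (hN : 1 ≤ N)
    (hΛN : 4 * (Real.pi * Λ) ≤ 3 ^ (N + 1)) {q : ℝ} (hq : 1 ≤ q)
    (hfin : ∫⁻ t : ℝ, ‖F t‖ₑ ^ q ≠ ∞) :
    ∫⁻ t : ℝ, ‖F t‖ₑ ^ q
      ≤ 2 * (ENNReal.ofReal ((γ / 28) ^ N / 5) ^ q * ENNReal.ofReal (γ / 2))⁻¹ *
          ∫⁻ t in E, ‖F (t : ℝ)‖ₑ ^ q := by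
  set A := ENNReal.ofReal (Real.pi * Λ) with hA
  set K := (ENNReal.ofReal ((γ / 28) ^ N / 5) ^ q * ENNReal.ofReal (γ / 2))⁻¹ with hK
  have hq0 : 0 < q := by linarith
  have hcont := continuous_ofReal_of_differentiableOn_strip hF
  have hA0 : A ≠ 0 := by
    rw [hA, Ne, ENNReal.ofReal_eq_zero, not_le]; exact mul_pos Real.pi_pos hΛ
  have hAq0 : A ^ q ≠ 0 := by
    rw [Ne, ENNReal.rpow_eq_zero_iff_of_pos hq0]; exact hA0
  have hAqt : A ^ q ≠ ∞ := ENNReal.rpow_ne_top_of_nonneg hq0.le ENNReal.ofReal_ne_top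
  have h1 : ∫⁻ t : ℝ, ‖F t‖ₑ ^ q ≤ (2 * A ^ q)⁻¹ * (∫⁻ x, weightedMean Λ (fun t => F t) x ^ q)
      + K * ∫⁻ t in E, ‖F (t : ℝ)‖ₑ ^ q := by
    rw [lintegral_eq_tsum_setLIntegral_Ioc, lintegral_eq_tsum_setLIntegral_Ioc,
      setLIntegral_eq_tsum_Ioc_inter E, ← ENNReal.tsum_mul_left, ← ENNReal.tsum_mul_left,
      ← ENNReal.tsum_add]
    exact ENNReal.tsum_le_tsum fun k => setLIntegral_Ioc_le hF hΛ hFΛ hγ hE hN hΛN hq k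
  have h2 : (2 * A ^ q)⁻¹ * ∫⁻ x, weightedMean Λ (fun t => F t) x ^ q
      ≤ 2⁻¹ * ∫⁻ t : ℝ, ‖F t‖ₑ ^ q := by
    calc _ ≤ (2 * A ^ q)⁻¹ * (A ^ q * ∫⁻ t : ℝ, ‖F t‖ₑ ^ q) := by
          gcongr
          exact lintegral_weightedMean_rpow_le hΛ.le hcont.aestronglyMeasurable hq
      _ = _ := by
          rw [ENNReal.mul_inv (Or.inl two_ne_zero) (Or.inl ENNReal.ofNat_ne_top), mul_assoc,
            ← mul_assoc (A ^ q)⁻¹, ENNReal.inv_mul_cancel hAq0 hAqt, one_mul]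
  set X := ∫⁻ t : ℝ, ‖F t‖ₑ ^ q with hX
  have h3 : 2⁻¹ * X + 2⁻¹ * X ≤ 2⁻¹ * X + K * ∫⁻ t in E, ‖F (t : ℝ)‖ₑ ^ q := by
    rw [← add_mul, ENNReal.inv_two_add_inv_two, one_mul]
    exact h1.trans (add_le_add_left h2 _)
  have h4 := (ENNReal.add_le_add_iff_left (ENNReal.mul_ne_top (by simp) hfin)).1 h3
  rw [ENNReal.inv_mul_le_iff two_ne_zero ENNReal.ofNat_ne_top, ← mul_assoc] at h4
  exact h4

/-- For `p = ∞` a single unit interval suffices, one on which `|F|` exceeds half of its essential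
supremum. -/
lemma mul_eLpNorm_top_le {F : ℂ → ℂ} (hF : DifferentiableOn ℂ F {z | |z.im| < 5}) {Λ : ℝ}
    (hΛ : 0 < Λ)
    (hFΛ : ∀ x : ℝ, ∀ z ∈ Metric.closedBall (x : ℂ) 5, ‖F z‖ₑ ≤ weightedMean Λ (fun t => F t) x)
    {γ : ℝ} (hγ : 0 < γ) {E : Set ℝ} (hE : IsThick 1 γ E) {N : ℕ} (hN : 1 ≤ N)
    (hΛN : 4 * (Real.pi * Λ) ≤ 3 ^ (N + 1)) (hfin : eLpNorm (fun t : ℝ => F t) ∞ volume ≠ ∞) :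
    ENNReal.ofReal ((γ / 28) ^ N / 5 / 2) * eLpNorm (fun t : ℝ => F t) ∞ volume
      ≤ eLpNorm (fun t : ℝ => F t) ∞ (volume.restrict E) := by
  set X := eLpNorm (fun t : ℝ => F t) ∞ volume with hX
  rcases eq_or_ne X 0 with h0 | h0
  · rw [h0, mul_zero]; exact zero_le
  obtain ⟨t, ht⟩ : ∃ t : ℝ, X / 2 < ‖F t‖ₑ := by
    by_contra! h
    have h1 : X ≤ X / 2 := by
      rw [hX, eLpNorm_exponent_top, eLpNormEssSup_eq_essSup_enorm]
      exact essSup_le_of_ae_le _ (Filter.Eventually.of_forall h)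
    exact absurd (ENNReal.half_lt_self h0 hfin) (not_lt.2 h1)
  obtain ⟨x₀, hx₀, hmax⟩ := exists_norm_le_on_unit_Icc hF t
  have htmem : t ∈ Icc t (t + 1) := ⟨le_rfl, by linarith⟩
  have hX2 : X ≤ 2 * ‖F (x₀ : ℝ)‖ₑ := by
    rw [← ENNReal.div_le_iff' two_ne_zero ENNReal.ofNat_ne_top]
    exact ht.le.trans (enorm_le_iff_norm_le.2 (hmax t htmem))
  have hFx₀ : F x₀ ≠ 0 := by
    intro h
    rw [h, enorm_zero, mul_zero] at hX2
    exact h0 (le_antisymm hX2 zero_le)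
  have hM : ∀ z ∈ Metric.closedBall (t : ℂ) 5, ‖F z‖ ≤ (2 * (Real.pi * Λ)) * ‖F x₀‖ := by
    intro z hz
    have h1 := (hFΛ t z hz).trans ((weightedMean_le_mul_eLpNorm_top hΛ.le _ t).trans
      (mul_le_mul_left hX2 _))
    have hpos : 0 ≤ Real.pi * Λ := (mul_pos Real.pi_pos hΛ).le
    rw [← ofReal_norm, ← ofReal_norm, ← ENNReal.ofReal_ofNat, ← ENNReal.ofReal_mul (by norm_num),
      ← ENNReal.ofReal_mul (by positivity), ENNReal.ofReal_le_ofReal_iff (by positivity)] at h1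
    linarith
  have hvolG := le_volume_setOf_lt_norm hF hγ hE htmem hx₀ hM hFx₀ hN (by linarith)
  set ε := (γ / 28) ^ N / 5 with hε
  have hε0 : 0 < ε := by positivity
  have h5 : ENNReal.ofReal ε * ‖F (x₀ : ℝ)‖ₑ
      ≤ eLpNorm (fun t : ℝ => F t) ∞ (volume.restrict E) := by
    by_contra! hlt
    rw [eLpNorm_exponent_top] at hlt
    have h6 := ae_lt_of_essSup_lt hlt
    have h7 : (volume.restrict E) {t : ℝ | ε * ‖F x₀‖ < ‖F t‖} = 0 := by
      rw [← nonpos_iff_eq_zero, ← ae_iff.1 h6]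
      refine measure_mono fun s hs => ?_
      simp only [mem_ofPred_eq, not_lt] at hs ⊢
      rw [← ofReal_norm, ← ofReal_norm, ← ENNReal.ofReal_mul hε0.le]
      exact ENNReal.ofReal_le_ofReal hs.le
    have hmeas : MeasurableSet {t : ℝ | ε * ‖F x₀‖ < ‖F t‖} :=
      (isOpen_lt continuous_const
        (continuous_ofReal_of_differentiableOn_strip hF).norm).measurableSet
    rw [Measure.restrict_apply hmeas] at h7
    have h8 : ENNReal.ofReal (γ / 2) ≤ 0 := by
      refine hvolG.trans ((measure_mono ?_).trans h7.le)
      exact fun s hs => ⟨hs.2, hs.1.1⟩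
    have : γ / 2 ≤ 0 := by simpa using h8
    linarith
  calc _ ≤ ENNReal.ofReal (ε / 2) * (2 * ‖F (x₀ : ℝ)‖ₑ) := by gcongr
    _ = ENNReal.ofReal ε * ‖F (x₀ : ℝ)‖ₑ := by
        rw [← mul_assoc, ← ENNReal.ofReal_ofNat, ← ENNReal.ofReal_mul (by positivity)]
        congr 2; simp
    _ ≤ _ := h5

lemma IsThick.le_one {a γ : ℝ} {E : Set ℝ} (ha : 0 < a) (hE : IsThick a γ E) : γ ≤ 1 := by
  have h := (hE.2 0).trans (measure_mono inter_subset_right)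
  rw [Real.volume_Icc, ENNReal.ofReal_le_ofReal_iff (by linarith)] at h
  nlinarith

/-- The Logvinenko–Sereda inequality for the restriction to the real line of a function `F` that
is holomorphic in a strip and is controlled there by a weighted mean of its real values. -/
theorem pow_mul_eLpNorm_le {F : ℂ → ℂ} (hF : DifferentiableOn ℂ F {z | |z.im| < 5}) {Λ : ℝ}
    (hΛ : 0 < Λ)
    (hFΛ : ∀ x : ℝ, ∀ z ∈ Metric.closedBall (x : ℂ) 5, ‖F z‖ₑ ≤ weightedMean Λ (fun t => F t) x)
    {γ : ℝ} (hγ : 0 < γ) {E : Set ℝ} (hE : IsThick 1 γ E) {N : ℕ} (hN : 1 ≤ N)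
    (hΛN : 4 * (Real.pi * Λ) ≤ 3 ^ (N + 1)) {p : ℝ≥0∞} (hp : 1 ≤ p)
    (hfin : eLpNorm (fun t : ℝ => F t) p volume ≠ ∞) :
    ENNReal.ofReal ((γ / 28) ^ (N + 1)) * eLpNorm (fun t : ℝ => F t) p volume
      ≤ eLpNorm (fun t : ℝ => F t) p (volume.restrict E) := by
  have hγ1 := hE.le_one one_pos
  have hεpos : 0 < (γ / 28) ^ N := by positivity
  -- the extra factor `γ / 28` absorbs the constants: `γ / 28 ≤ 1 / 10`, and below
  -- `γ / 28 ≤ γ / 4 / 5`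
  rcases eq_or_ne p ∞ with rfl | hp'
  · refine le_trans ?_ (mul_eLpNorm_top_le hF hΛ hFΛ hγ hE hN hΛN hfin)
    gcongr
    rw [pow_succ]
    nlinarith
  have hp0 : p ≠ 0 := (zero_lt_one.trans_le hp).ne'
  set q := p.toReal with hq
  have hq1 : 1 ≤ q := by
    rw [hq, ← ENNReal.toReal_one]; exact (ENNReal.toReal_le_toReal (by simp) hp').2 hp
  have hq0 : 0 < q := by linarith
  set ε := (γ / 28) ^ N / 5 with hε
  have hε0 : 0 < ε := by positivity
  have hX : ∫⁻ t : ℝ, ‖F t‖ₑ ^ q ≠ ∞ := by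
    have := lintegral_rpow_enorm_lt_top_of_eLpNorm_lt_top hp0 hp' hfin.lt_top
    exact this.ne
  have h1 := lintegral_rpow_le hF hΛ hFΛ hγ hE hN hΛN hq1 hX
  rw [← hε] at h1
  have hK0 : ENNReal.ofReal ε ^ q * ENNReal.ofReal (γ / 2) ≠ 0 := by
    refine mul_ne_zero ?_ (by simpa using hγ)
    rw [Ne, ENNReal.rpow_eq_zero_iff_of_pos hq0]; simpa using hε0
  have hKt : ENNReal.ofReal ε ^ q * ENNReal.ofReal (γ / 2) ≠ ∞ :=
    ENNReal.mul_ne_top (ENNReal.rpow_ne_top_of_nonneg hq0.le ENNReal.ofReal_ne_top)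
      ENNReal.ofReal_ne_top
  have h2 : ENNReal.ofReal ε ^ q * ENNReal.ofReal (γ / 4) * ∫⁻ t : ℝ, ‖F t‖ₑ ^ q
      ≤ ∫⁻ t in E, ‖F (t : ℝ)‖ₑ ^ q := by
    rw [mul_assoc, ← ENNReal.inv_mul_le_iff two_ne_zero ENNReal.ofNat_ne_top,
      ← ENNReal.mul_le_iff_le_inv hK0 hKt] at h1
    refine le_trans (le_of_eq ?_) h1
    rw [show γ / 4 = γ / 2 * 2⁻¹ by ring, ENNReal.ofReal_mul (by positivity),
      ENNReal.ofReal_inv_of_pos two_pos, ENNReal.ofReal_ofNat]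
    ring
  rw [eLpNorm_eq_lintegral_rpow_enorm_toReal hp0 hp',
    eLpNorm_eq_lintegral_rpow_enorm_toReal hp0 hp', ← hq, ← ENNReal.rpow_le_rpow_iff hq0,
    ENNReal.mul_rpow_of_nonneg _ _ hq0.le, ← ENNReal.rpow_mul, ← ENNReal.rpow_mul,
    one_div_mul_cancel hq0.ne', ENNReal.rpow_one, ENNReal.rpow_one]
  refine le_trans ?_ h2
  gcongr
  calc ENNReal.ofReal ((γ / 28) ^ (N + 1)) ^ q
      ≤ (ENNReal.ofReal ε * ENNReal.ofReal (γ / 4)) ^ q := by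
        refine ENNReal.rpow_le_rpow ?_ hq0.le
        rw [← ENNReal.ofReal_mul hε0.le]
        refine ENNReal.ofReal_le_ofReal ?_
        rw [pow_succ]
        nlinarith
    _ = ENNReal.ofReal ε ^ q * ENNReal.ofReal (γ / 4) ^ q := ENNReal.mul_rpow_of_nonneg _ _ hq0.le
    _ ≤ _ := by
        gcongr
        conv_rhs => rw [← ENNReal.rpow_one (ENNReal.ofReal (γ / 4))]
        refine ENNReal.rpow_le_rpow_of_exponent_ge ?_ hq1
        rw [← ENNReal.ofReal_one]
        exact ENNReal.ofReal_le_ofReal (by linarith)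

/-! ### Fourier–Laplace transforms and plateau kernels -/

/-- The Fourier–Laplace transform `∫ θ(s) e^{izs} ds` of `θ : ℝ → ℂ` at the complex
frequency `z`. -/
noncomputable def fourierLaplace (θ : ℝ → ℂ) (z : ℂ) : ℂ :=
  ∫ s : ℝ, θ s * Complex.exp (Complex.I * z * s)

lemma norm_exp_I_mul_le {b s : ℝ} (hs : s ∈ Icc (-b) b) (z : ℂ) :
    ‖Complex.exp (Complex.I * z * s)‖ ≤ Real.exp (b * |z.im|) := by
  rw [Complex.norm_exp]
  refine Real.exp_le_exp.2 ?_
  have h1 : (Complex.I * z * s).re = -(z.im * s) := by simp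
  rw [h1, ← abs_neg z.im]
  have h2 : |s| ≤ b := abs_le.2 hs
  calc -(z.im * s) = -z.im * s := by ring
    _ ≤ |(-z.im)| * |s| := by rw [← abs_mul]; exact le_abs_self _
    _ ≤ |(-z.im)| * b := by gcongr
    _ = _ := mul_comm _ _

lemma fourierLaplace_eq_setIntegral {θ : ℝ → ℂ} {b : ℝ} (h0 : ∀ s ∉ Icc (-b) b, θ s = 0) (z : ℂ) :
    fourierLaplace θ z = ∫ s in Icc (-b) b, θ s * Complex.exp (Complex.I * z * s) := by
  rw [setIntegral_eq_integral_of_forall_compl_eq_zero]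
  · rfl
  · intro s hs
    rw [h0 s hs, zero_mul]

lemma norm_fourierLaplace_le {θ : ℝ → ℂ} {b D : ℝ} (hb : 0 ≤ b)
    (h0 : ∀ s ∉ Icc (-b) b, θ s = 0) (hD : ∀ s, ‖θ s‖ ≤ D) (z : ℂ) :
    ‖fourierLaplace θ z‖ ≤ 2 * b * D * Real.exp (b * |z.im|) := by
  have hD0 : 0 ≤ D := (norm_nonneg _).trans (hD 0)
  rw [fourierLaplace_eq_setIntegral h0]
  refine (norm_setIntegral_le_of_norm_le_const (C := D * Real.exp (b * |z.im|))
    (by rw [Real.volume_Icc]; exact ENNReal.ofReal_lt_top) fun s hs => ?_).trans (le_of_eq ?_)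
  · rw [norm_mul]
    exact mul_le_mul (hD s) (norm_exp_I_mul_le hs z) (norm_nonneg _) hD0
  · rw [measureReal_def, Real.volume_Icc, ENNReal.toReal_ofReal (by linarith)]
    ring

/-- Integration by parts. -/
lemma mul_fourierLaplace {θ θ' : ℝ → ℂ} (hθ : ∀ s, HasDerivAt θ (θ' s) s) (hθ' : Continuous θ')
    {b : ℝ} (h0 : ∀ s ∉ Icc (-b) b, θ s = 0) (h0' : ∀ s ∉ Icc (-b) b, θ' s = 0) (z : ℂ) :
    Complex.I * z * fourierLaplace θ z = -fourierLaplace θ' z := by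
  have hcs : ∀ η : ℝ → ℂ, (∀ s ∉ Icc (-b) b, η s = 0) → HasCompactSupport η := fun η h =>
    HasCompactSupport.intro isCompact_Icc h
  have hc : Continuous θ := continuous_iff_continuousAt.2 fun s => (hθ s).continuousAt
  have hexp : Continuous fun s : ℝ => Complex.exp (Complex.I * z * s) := by fun_prop
  have hd : ∀ s : ℝ, HasDerivAt (fun s : ℝ => Complex.exp (Complex.I * z * s))
      (Complex.I * z * Complex.exp (Complex.I * z * s)) s := by
    intro s
    have h1 : HasDerivAt (fun w : ℂ => Complex.exp (Complex.I * z * w))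
        (Complex.exp (Complex.I * z * s) * (Complex.I * z * 1)) (s : ℂ) :=
      ((hasDerivAt_id (s : ℂ)).const_mul (Complex.I * z)).cexp
    rw [mul_one, mul_comm (Complex.exp _)] at h1
    exact h1.comp_ofReal
  have h := integral_mul_deriv_eq_deriv_mul_of_integrable (u := θ) (u' := θ')
    (v := fun s : ℝ => Complex.exp (Complex.I * z * s))
    (v' := fun s : ℝ => Complex.I * z * Complex.exp (Complex.I * z * s))
    (fun s _ => hθ s) (fun s _ => hd s)
    ((hc.mul (continuous_const.mul hexp)).integrable_of_hasCompactSupport ((hcs θ h0).mul_right))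
    ((hθ'.mul hexp).integrable_of_hasCompactSupport ((hcs θ' h0').mul_right))
    ((hc.mul hexp).integrable_of_hasCompactSupport ((hcs θ h0).mul_right))
  rw [fourierLaplace, fourierLaplace, ← h, ← integral_const_mul]
  refine integral_congr_ae (Filter.Eventually.of_forall fun s => ?_)
  simp only
  ring

/-- Two integrations by parts give the quadratic decay. -/
lemma norm_fourierLaplace_le_inv_one_add_sq {θ θ' θ'' : ℝ → ℂ}
    (hθ : ∀ s, HasDerivAt θ (θ' s) s) (hθ' : ∀ s, HasDerivAt θ' (θ'' s) s) (hθ'' : Continuous θ'')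
    {b D : ℝ} (hb : 0 ≤ b) (h0 : ∀ s ∉ Icc (-b) b, θ s = 0) (h0' : ∀ s ∉ Icc (-b) b, θ' s = 0)
    (h0'' : ∀ s ∉ Icc (-b) b, θ'' s = 0) (hD : ∀ s, ‖θ s‖ ≤ D) (hD'' : ∀ s, ‖θ'' s‖ ≤ D) (z : ℂ) :
    ‖fourierLaplace θ z‖ ≤ 4 * b * D * Real.exp (b * |z.im|) * (1 + z.re ^ 2)⁻¹ := by
  have hc' : Continuous θ' := continuous_iff_continuousAt.2 fun s => (hθ' s).continuousAt
  have h1 := norm_fourierLaplace_le hb h0 hD z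
  have h2 : ‖z‖ ^ 2 * ‖fourierLaplace θ z‖ ≤ 2 * b * D * Real.exp (b * |z.im|) := by
    refine le_trans (le_of_eq ?_) (norm_fourierLaplace_le hb h0'' hD'' z)
    have e1 := mul_fourierLaplace hθ hc' h0 h0' z
    have e2 := mul_fourierLaplace hθ' hθ'' h0' h0'' z
    have e3 : fourierLaplace θ'' z = (Complex.I * z) ^ 2 * fourierLaplace θ z := by
      rw [sq, mul_assoc, e1, mul_neg, e2, neg_neg]
    rw [e3, norm_mul, norm_pow, norm_mul, Complex.norm_I, one_mul]
  have h3 : z.re ^ 2 ≤ ‖z‖ ^ 2 := by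
    rw [← sq_abs]; exact pow_le_pow_left₀ (abs_nonneg _) (Complex.abs_re_le_norm z) 2
  rw [← div_eq_mul_inv, le_div_iff₀ (by positivity)]
  nlinarith [mul_le_mul_of_nonneg_right h3 (norm_nonneg (fourierLaplace θ z))]

lemma differentiable_fourierLaplace {θ : ℝ → ℂ} (hθ : Continuous θ) {b : ℝ}
    (h0 : ∀ s ∉ Icc (-b) b, θ s = 0) : Differentiable ℂ (fourierLaplace θ) := by
  intro z₀
  have hcs : HasCompactSupport θ := HasCompactSupport.intro isCompact_Icc h0
  have hint : ∀ η : ℝ → ℂ, Continuous η → Integrable (fun s => θ s * η s) := fun η hη =>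
    (hθ.mul hη).integrable_of_hasCompactSupport hcs.mul_right
  have h := hasDerivAt_integral_of_dominated_loc_of_deriv_le (μ := volume) (𝕜 := ℂ)
    (F := fun (z : ℂ) (s : ℝ) => θ s * Complex.exp (Complex.I * z * s))
    (F' := fun (z : ℂ) (s : ℝ) => θ s * (Complex.I * s * Complex.exp (Complex.I * z * s)))
    (x₀ := z₀) (s := Metric.ball z₀ 1)
    (bound := fun s : ℝ => ‖θ s * ((|s| * Real.exp (b * (|z₀.im| + 1)) : ℝ) : ℂ)‖)
    (Metric.ball_mem_nhds _ one_pos)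
    (Filter.Eventually.of_forall fun z => (hint _ (by fun_prop)).aestronglyMeasurable)
    (hint _ (by fun_prop)) (hint _ (by fun_prop)).aestronglyMeasurable
    (Filter.Eventually.of_forall fun s z hz => ?_)
    (hint (fun s => ((|s| * Real.exp (b * (|z₀.im| + 1)) : ℝ) : ℂ)) (by fun_prop)).norm
    (Filter.Eventually.of_forall fun s z hz => ?_)
  · exact h.2.differentiableAt
  · by_cases hs : s ∈ Icc (-b) b
    · rw [norm_mul (θ s), norm_mul (θ s)]
      refine mul_le_mul_of_nonneg_left ?_ (norm_nonneg (θ s))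
      rw [norm_mul, norm_mul, Complex.norm_I, one_mul, Complex.norm_real, Complex.norm_real,
        Real.norm_eq_abs, Real.norm_eq_abs, abs_mul, abs_abs, abs_of_pos (Real.exp_pos _)]
      refine mul_le_mul_of_nonneg_left ?_ (abs_nonneg _)
      refine (norm_exp_I_mul_le hs z).trans (Real.exp_le_exp.2 ?_)
      have hb : 0 ≤ b := by linarith [hs.1, hs.2]
      have h1 := Complex.abs_im_le_norm (z - z₀)
      rw [mem_ball_iff_norm] at hz
      have h2 := abs_sub_abs_le_abs_sub z.im z₀.im
      rw [Complex.sub_im] at h1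
      gcongr
      linarith
    · simp [h0 s hs]
  · have h1 : HasDerivAt (fun z : ℂ => Complex.exp (Complex.I * z * s))
        (Complex.exp (Complex.I * z * s) * (Complex.I * 1 * s)) z :=
      (((hasDerivAt_id z).const_mul Complex.I).mul_const (s : ℂ)).cexp
    have h2 := h1.const_mul (θ s)
    rw [mul_one, mul_comm (Complex.exp _)] at h2
    exact h2

/-- The weight `1 / (1 + t²)` defines a finite measure dominated by Lebesgue measure, so functions
in `L^p` are integrable against it for every `p ≥ 1`. -/
lemma integrable_weight_mul {p : ℝ≥0∞} (hp : 1 ≤ p) {g : ℝ → ℂ} (hg : MemLp g p volume) (x : ℝ) :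
    Integrable (fun s => (1 + (x - s) ^ 2)⁻¹ * ‖g s‖) := by
  set ρ : ℝ → ℝ≥0∞ := fun s => ENNReal.ofReal ((1 + (x - s) ^ 2)⁻¹) with hρ
  have hρm : Measurable ρ := by fun_prop
  have hρ1 : ∀ s, ρ s ≤ 1 := fun s => by
    rw [hρ, ← ENNReal.ofReal_one]
    exact ENNReal.ofReal_le_ofReal (inv_le_one_of_one_le₀ (by nlinarith [sq_nonneg (x - s)]))
  set ν := volume.withDensity ρ with hν
  have hle : ν ≤ volume := by
    rw [hν]
    calc volume.withDensity ρ ≤ volume.withDensity 1 := withDensity_mono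
          (Filter.Eventually.of_forall hρ1)
      _ = volume := withDensity_one
  have hfin : IsFiniteMeasure ν := by
    refine ⟨?_⟩
    rw [hν, withDensity_apply _ MeasurableSet.univ, setLIntegral_univ]
    have h := lintegral_weight_left zero_le_one x
    simp only [one_mul, mul_one] at h
    rw [hρ, h]
    exact ENNReal.ofReal_lt_top
  have h1 : Integrable (fun s => ‖g s‖) ν := ((hg.mono_measure hle).integrable hp).norm
  rw [hν, integrable_withDensity_iff_integrable_smul' hρm
    (Filter.Eventually.of_forall fun _ => ENNReal.ofReal_lt_top)] at h1
  refine h1.congr (Filter.Eventually.of_forall fun s => ?_)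
  simp only [hρ, smul_eq_mul]
  rw [ENNReal.toReal_ofReal (by positivity)]

section Convolution

variable {κ : ℂ → ℂ} {L : ℝ} {p : ℝ≥0∞} {g : ℝ → ℂ}

lemma inv_one_add_sub_sq_le {x u s R : ℝ} (h : |u - x| ≤ R) :
    (1 + (u - s) ^ 2)⁻¹ ≤ 2 * (1 + R ^ 2) * (1 + (x - s) ^ 2)⁻¹ := by
  rw [← div_eq_mul_inv, inv_le_comm₀ (by positivity) (by positivity), inv_div,
    div_le_iff₀ (by positivity)]
  have h1 := one_add_add_sq_le (u - s) (x - u)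
  rw [show u - s + (x - u) = x - s by ring] at h1
  have h2 : (x - u) ^ 2 ≤ R ^ 2 := by
    rw [← sq_abs, abs_sub_comm]; exact pow_le_pow_left₀ (abs_nonneg _) h 2
  refine h1.trans ?_
  nlinarith [sq_nonneg (u - s)]

lemma norm_kernel_le (hL : 0 ≤ L)
    (hκL : ∀ z : ℂ, |z.im| ≤ 6 → ‖κ z‖ ≤ L * (1 + z.re ^ 2)⁻¹) {x s R : ℝ} {z : ℂ}
    (hzi : |z.im| ≤ 6) (hz : |z.re - x| ≤ R) :
    ‖κ (z - s)‖ ≤ 2 * (1 + R ^ 2) * L * (1 + (x - s) ^ 2)⁻¹ := by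
  refine (hκL _ (by simpa using hzi)).trans ?_
  have := mul_le_mul_of_nonneg_left (inv_one_add_sub_sq_le (s := s) hz) hL
  simp only [Complex.sub_re, Complex.ofReal_re]
  linarith

/-- The convolution of `g` with a kernel decaying quadratically in a strip is bounded, on a whole
disc of radius `5` about a real point, by a weighted mean of `‖g‖` at that point. The constant is
`52 = 2 (1 + 5²)`. -/
lemma enorm_integral_mul_kernel_le (hL : 0 ≤ L)
    (hκL : ∀ z : ℂ, |z.im| ≤ 6 → ‖κ z‖ ≤ L * (1 + z.re ^ 2)⁻¹) {x : ℝ} {z : ℂ}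
    (hz : z ∈ Metric.closedBall (x : ℂ) 5) :
    ‖∫ s, g s * κ (z - s)‖ₑ ≤ weightedMean (52 * L) g x := by
  refine (enorm_integral_le_lintegral_enorm _).trans (lintegral_mono fun s => ?_)
  rw [enorm_mul]
  gcongr
  rw [mem_closedBall_iff_norm] at hz
  have h1 := (Complex.abs_im_le_norm (z - x)).trans hz
  have h2 := (Complex.abs_re_le_norm (z - x)).trans hz
  simp only [Complex.sub_im, Complex.ofReal_im, sub_zero, Complex.sub_re, Complex.ofReal_re] at h1 h2
  rw [← ofReal_norm]
  refine ENNReal.ofReal_le_ofReal ((norm_kernel_le hL hκL (by linarith) h2).trans (le_of_eq ?_))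
  norm_num

lemma integrable_mul_kernel (hκ : Continuous κ) (hL : 0 ≤ L)
    (hκL : ∀ z : ℂ, |z.im| ≤ 6 → ‖κ z‖ ≤ L * (1 + z.re ^ 2)⁻¹) (hp : 1 ≤ p)
    (hg : MemLp g p volume) {z : ℂ} (hz : |z.im| ≤ 6) :
    Integrable fun s : ℝ => g s * κ (z - s) := by
  have hi := (integrable_weight_mul hp hg z.re).const_mul (2 * (1 + 0 ^ 2) * L)
  refine hi.mono' (hg.1.mul (by fun_prop : Continuous fun s : ℝ => κ (z - s)).aestronglyMeasurable)
    (Filter.Eventually.of_forall fun s => ?_)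
  rw [norm_mul, ← mul_assoc, mul_comm]
  exact mul_le_mul_of_nonneg_right (norm_kernel_le hL hκL hz (by simp)) (norm_nonneg _)

lemma differentiableOn_integral_mul_kernel (hκ : Differentiable ℂ κ) (hL : 0 ≤ L)
    (hκL : ∀ z : ℂ, |z.im| ≤ 6 → ‖κ z‖ ≤ L * (1 + z.re ^ 2)⁻¹) (hp : 1 ≤ p)
    (hg : MemLp g p volume) :
    DifferentiableOn ℂ (fun z => ∫ s : ℝ, g s * κ (z - s)) {z | |z.im| < 5} := by
  intro z₀ hz₀
  have hz₀ : |z₀.im| < 5 := hz₀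
  refine DifferentiableAt.differentiableWithinAt ?_
  have him : ∀ {w z : ℂ} {r : ℝ}, w ∈ Metric.closedBall z r → |w.im| ≤ |z.im| + r := by
    intro w z r hw
    have h1 := Complex.abs_im_le_norm (w - z)
    rw [mem_closedBall_iff_norm] at hw
    have h2 := abs_sub_abs_le_abs_sub w.im z.im
    rw [Complex.sub_im] at h1
    linarith
  have hder : Continuous (deriv κ) :=
    (hκ.contDiff (n := 1)).continuous_deriv le_rfl
  -- the derivative of the kernel is dominated by Cauchy's estimate on circles of radius `1 / 2`,
  -- which stay inside `|Im z| ≤ 6`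
  have h := hasDerivAt_integral_of_dominated_loc_of_deriv_le (μ := volume) (𝕜 := ℂ)
    (F := fun (z : ℂ) (s : ℝ) => g s * κ (z - s))
    (F' := fun (z : ℂ) (s : ℝ) => g s * deriv κ (z - s))
    (x₀ := z₀) (s := Metric.ball z₀ (1 / 2))
    (bound := fun s => 2 * (2 * (1 + 1 ^ 2) * L) * ((1 + (z₀.re - s) ^ 2)⁻¹ * ‖g s‖))
    (Metric.ball_mem_nhds _ (by norm_num))
    (Filter.Eventually.of_forall fun z => hg.1.mul
      (hκ.continuous.comp (by fun_prop : Continuous fun s : ℝ => z - s)).aestronglyMeasurable)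
    (integrable_mul_kernel hκ.continuous hL hκL hp hg (by linarith))
    (hg.1.mul (hder.comp (by fun_prop : Continuous fun s : ℝ => z₀ - s)).aestronglyMeasurable)
    (Filter.Eventually.of_forall fun s z hz => ?_)
    ((integrable_weight_mul hp hg z₀.re).const_mul _)
    (Filter.Eventually.of_forall fun s z hz => ?_)
  · exact h.2.differentiableAt
  · have hz' := Metric.ball_subset_closedBall hz
    have hd : ‖deriv κ (z - s)‖ ≤ 2 * (1 + 1 ^ 2) * L * (1 + (z₀.re - s) ^ 2)⁻¹ / (1 / 2) := by
      refine Complex.norm_deriv_le_of_forall_mem_sphere_norm_le (by norm_num)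
        hκ.diffContOnCl fun w hw => ?_
      have hw' : w + s ∈ Metric.closedBall z (1 / 2) := by
        rw [mem_closedBall_iff_norm, show w + s - z = w - (z - s) by ring]
        exact (mem_sphere_iff_norm.1 hw).le
      have h3 : w + s ∈ Metric.closedBall z₀ 1 := by
        rw [Metric.mem_closedBall] at *
        linarith [dist_triangle (w + s) z z₀]
      have h4 := norm_kernel_le hL hκL (z := w + s) (x := z₀.re) (s := s) (R := 1)
        (by linarith [him h3])
        (by
          rw [mem_closedBall_iff_norm] at h3
          have := Complex.abs_re_le_norm (w + s - z₀)
          rw [Complex.sub_re] at this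
          linarith)
      rwa [add_sub_cancel_right] at h4
    rw [norm_mul]
    have := mul_le_mul_of_nonneg_left hd (norm_nonneg (g s))
    refine this.trans (le_of_eq ?_)
    ring
  · have h1 := (hκ (z - s)).hasDerivAt.comp_sub_const z (s : ℂ)
    exact h1.const_mul (g s)

end Convolution

lemma exists_bound_smoothTransition_deriv :
    ∃ D : ℝ, 1 ≤ D ∧ (∀ x, |deriv Real.smoothTransition x| ≤ D) ∧
      ∀ x, |deriv (deriv Real.smoothTransition) x| ≤ D := by
  have hS := Real.smoothTransition.contDiff (n := 2)
  have hS1 : Continuous (deriv Real.smoothTransition) := hS.continuous_deriv (by norm_num)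
  have hS2 : Continuous (deriv (deriv Real.smoothTransition)) :=
    (contDiff_succ_iff_deriv.1 (show ContDiff ℝ (1 + 1) Real.smoothTransition from
      Real.smoothTransition.contDiff)).2.2.continuous_deriv le_rfl
  have hlo : ∀ x < (0 : ℝ), Real.smoothTransition =ᶠ[nhds x] fun _ => 0 := fun x hx => by
    filter_upwards [Iio_mem_nhds hx] with y hy using
      Real.smoothTransition.zero_of_nonpos (le_of_lt hy)
  have hhi : ∀ x > (1 : ℝ), Real.smoothTransition =ᶠ[nhds x] fun _ => 1 := fun x hx => by
    filter_upwards [Ioi_mem_nhds hx] with y hy using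
      Real.smoothTransition.one_of_one_le (le_of_lt hy)
  have hz1 : ∀ x ∉ Icc (0 : ℝ) 1, deriv Real.smoothTransition x = 0 := by
    intro x hx
    rcases lt_or_ge x 0 with h | h
    · rw [(hlo x h).deriv_eq]; simp
    · rw [(hhi x (by by_contra h'; exact hx ⟨h, not_lt.1 h'⟩)).deriv_eq]; simp
  have hz2 : ∀ x ∉ Icc (0 : ℝ) 1, deriv (deriv Real.smoothTransition) x = 0 := by
    intro x hx
    have : deriv Real.smoothTransition =ᶠ[nhds x] fun _ => 0 := by
      filter_upwards [isClosed_Icc.isOpen_compl.mem_nhds hx] with y hy using hz1 y hy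
    rw [this.deriv_eq]; simp
  obtain ⟨C1, hC1⟩ := (HasCompactSupport.intro isCompact_Icc hz1).exists_bound_of_continuous hS1
  obtain ⟨C2, hC2⟩ := (HasCompactSupport.intro isCompact_Icc hz2).exists_bound_of_continuous hS2
  exact ⟨max 1 (max C1 C2), le_max_left _ _,
    fun x => (hC1 x).trans ((le_max_left _ _).trans (le_max_right _ _)),
    fun x => (hC2 x).trans ((le_max_right _ _).trans (le_max_right _ _))⟩

/-- A smooth even cutoff, equal to `1` on `[-(b - 1), b - 1]` and supported in `[-b, b]`. -/
noncomputable def plateau (b s : ℝ) : ℂ :=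
  ((Real.smoothTransition (s + b) * Real.smoothTransition (b - s) : ℝ) : ℂ)

lemma plateau_eq_one {b s : ℝ} (hs : |s| ≤ b - 1) : plateau b s = 1 := by
  rw [abs_le] at hs
  rw [plateau, Real.smoothTransition.one_of_one_le (by linarith),
    Real.smoothTransition.one_of_one_le (by linarith)]
  simp

lemma plateau_eq_zero {b s : ℝ} (hs : s ∉ Icc (-b) b) : plateau b s = 0 := by
  rw [plateau]
  rw [mem_Icc, not_and_or, not_le, not_le] at hs
  rcases hs with h | h
  · rw [Real.smoothTransition.zero_of_nonpos (x := s + b) (by linarith)]; simp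
  · rw [Real.smoothTransition.zero_of_nonpos (x := b - s) (by linarith)]; simp

lemma contDiff_plateau (b : ℝ) {n : ℕ∞} : ContDiff ℝ n (plateau b) := by
  have h := (Real.smoothTransition.contDiff (n := n))
  exact Complex.ofRealCLM.contDiff.comp
    ((h.comp (contDiff_id.add contDiff_const)).mul (h.comp (contDiff_const.sub contDiff_id)))

/-- The bound for the plateau kernels, with a constant `D` independent of the half-width `b`: the
flanks of the plateau are translates of fixed functions. -/
lemma exists_norm_fourierLaplace_plateau_le :
    ∃ D : ℝ, 1 ≤ D ∧ ∀ b : ℝ, 0 ≤ b → ∀ z : ℂ,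
      ‖fourierLaplace (plateau b) z‖ ≤ 4 * b * D * Real.exp (b * |z.im|) * (1 + z.re ^ 2)⁻¹ := by
  obtain ⟨D, hD1, hd1, hd2⟩ := exists_bound_smoothTransition_deriv
  refine ⟨4 * D ^ 2, by nlinarith, fun b hb z => ?_⟩
  set S := Real.smoothTransition with hS
  have hSD : ∀ x, |S x| ≤ D := fun x => by
    rw [abs_of_nonneg (Real.smoothTransition.nonneg x)]
    exact (Real.smoothTransition.le_one x).trans hD1
  have hS1 : ContDiff ℝ 1 (deriv S) :=
    (contDiff_succ_iff_deriv.1 (show ContDiff ℝ (1 + 1) S from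
      Real.smoothTransition.contDiff)).2.2
  have hS2 : Continuous (deriv (deriv S)) := hS1.continuous_deriv le_rfl
  have hdS : ∀ x, HasDerivAt S (deriv S x) x := fun x =>
    ((Real.smoothTransition.contDiff (n := 1)).differentiable (by norm_num) x).hasDerivAt
  have hdS1 : ∀ x, HasDerivAt (deriv S) (deriv (deriv S) x) x := fun x =>
    (hS1.differentiable (by norm_num) x).hasDerivAt
  have hl : ∀ {f f' : ℝ → ℝ}, (∀ x, HasDerivAt f (f' x) x) →
      ∀ s, HasDerivAt (fun s => f (s + b)) (f' (s + b)) s :=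
    fun h s => (h (s + b)).comp_add_const s b
  have hr : ∀ {f f' : ℝ → ℝ}, (∀ x, HasDerivAt f (f' x) x) →
      ∀ s, HasDerivAt (fun s => f (b - s)) (-f' (b - s)) s :=
    fun h s => (h (b - s)).comp_const_sub b s
  set θ' : ℝ → ℝ := fun s => deriv S (s + b) * S (b - s) + S (s + b) * -deriv S (b - s) with hθ'
  set θ'' : ℝ → ℝ := fun s => (deriv (deriv S) (s + b) * S (b - s)
    + deriv S (s + b) * -deriv S (b - s)) + (deriv S (s + b) * -deriv S (b - s)
    + S (s + b) * -(-deriv (deriv S) (b - s))) with hθ''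
  have h1 : ∀ s, HasDerivAt (plateau b) ((θ' s : ℝ) : ℂ) s := fun s =>
    ((hl hdS s).mul (hr hdS s)).ofReal_comp
  have h2 : ∀ s, HasDerivAt (fun s => ((θ' s : ℝ) : ℂ)) ((θ'' s : ℝ) : ℂ) s := fun s =>
    (((hl hdS1 s).mul (hr hdS s)).add ((hl hdS s).mul (hr hdS1 s).neg)).ofReal_comp
  have hzero : ∀ {f f' : ℝ → ℂ}, (∀ s, HasDerivAt f (f' s) s) → (∀ s ∉ Icc (-b) b, f s = 0) →
      ∀ s ∉ Icc (-b) b, f' s = 0 := by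
    intro f f' hf h0 s hs
    have : f =ᶠ[nhds s] fun _ => 0 := by
      filter_upwards [isClosed_Icc.isOpen_compl.mem_nhds hs] with y hy using h0 y hy
    rw [← (hf s).deriv, this.deriv_eq]; simp
  have h0 := fun s (hs : s ∉ Icc (-b) b) => plateau_eq_zero hs
  have hprod : ∀ {u v : ℝ}, |u| ≤ D → |v| ≤ D → |u * v| ≤ D ^ 2 := fun hu hv => by
    rw [abs_mul, sq]; exact mul_le_mul hu hv (abs_nonneg _) (by linarith)
  refine norm_fourierLaplace_le_inv_one_add_sq h1 h2 ?_ hb h0 (hzero h1 h0)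
    (hzero h2 (hzero h1 h0)) ?_ ?_ z
  · refine Complex.continuous_ofReal.comp ?_
    have := Real.smoothTransition.continuous
    have h3 := hS1.continuous
    fun_prop
  · intro s
    rw [plateau, Complex.norm_real, Real.norm_eq_abs]
    exact (hprod (hSD _) (hSD _)).trans (by nlinarith)
  · intro s
    rw [Complex.norm_real, Real.norm_eq_abs]
    have t1 := hprod (hd2 (s + b)) (hSD (b - s))
    have t2 := hprod (hd1 (s + b)) ((abs_neg _).le.trans (hd1 (b - s)))
    have t3 := hprod (hSD (s + b)) (((abs_neg _).trans (abs_neg _)).le.trans (hd2 (b - s)))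
    refine (abs_add_le _ _).trans ?_
    have t4 := abs_add_le (deriv (deriv S) (s + b) * S (b - s)) (deriv S (s + b) * -deriv S (b - s))
    have t5 := abs_add_le (deriv S (s + b) * -deriv S (b - s))
      (S (s + b) * -(-deriv (deriv S) (b - s)))
    linarith

/-! ### Supports of tempered distributions -/

section Distributions
open scoped ContDiff Manifold

lemma contDiff_plateau_infty (b : ℝ) : ContDiff ℝ ∞ (plateau b) := contDiff_plateau b

lemma hasCompactSupport_plateau (b : ℝ) : HasCompactSupport (plateau b) :=
  HasCompactSupport.intro isCompact_Icc fun _ => plateau_eq_zero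

lemma hasCompactSupport_plateau_mul (b : ℝ) {c : ℝ} (hc : c ≠ 0) :
    HasCompactSupport fun x => plateau b (c * x) := by
  simpa only [smul_eq_mul] using (hasCompactSupport_plateau b).comp_smul hc

/-- Cutting off a Schwartz function far away changes it little in the Schwartz topology. -/
lemma tendsto_plateau_smul_schwartz (u : 𝓢(ℝ, ℂ)) (v : ℕ → 𝓢(ℝ, ℂ))
    (hv : ∀ n x, v n x = plateau 2 (((n : ℝ) + 1)⁻¹ * x) * u x) :
    Filter.Tendsto v Filter.atTop (nhds u) := by
  rw [(schwartz_withSeminorms ℂ ℝ ℂ).tendsto_nhds]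
  rintro ⟨k, m⟩ ε hε
  have hR : ∀ i : ℕ, ∃ R, ∀ x, ‖iteratedDeriv i (plateau 2) x‖ ≤ R := by
    intro i
    have h1 : HasCompactSupport (iteratedFDeriv ℝ i (plateau 2)) :=
      (hasCompactSupport_plateau 2).iteratedFDeriv i
    obtain ⟨R, hR⟩ := h1.exists_bound_of_continuous
      ((contDiff_plateau (n := i) 2).continuous_iteratedFDeriv' )
    exact ⟨R, fun x => by rw [← norm_iteratedFDeriv_eq_norm_iteratedDeriv]; exact hR x⟩
  choose R hR using hR
  have hR0 : ∀ i, 0 ≤ R i := fun i => (norm_nonneg _).trans (hR i 0)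
  set M : ℝ := SchwartzMap.seminorm ℂ (k + 1) m u + ∑ i ∈ Finset.range (m + 1),
    (m.choose i : ℝ) * R i * SchwartzMap.seminorm ℂ (k + 1) (m - i) u with hM
  have hM0 : 0 ≤ M := by
    refine add_nonneg (apply_nonneg _ _) (Finset.sum_nonneg fun i _ => ?_)
    exact mul_nonneg (mul_nonneg (by positivity) (hR0 i)) (apply_nonneg _ _)
  have key : ∀ n : ℕ, SchwartzMap.seminorm ℂ k m (v n - u) ≤ M / ((n : ℝ) + 1) := by
    intro n
    have hn : (0 : ℝ) < (n : ℝ) + 1 := by positivity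
    set c : ℝ := ((n : ℝ) + 1)⁻¹ with hc
    have hc0 : 0 < c := inv_pos.2 hn
    have hc1 : c ≤ 1 := inv_le_one_of_one_le₀ (by linarith [Nat.cast_nonneg (α := ℝ) n])
    refine SchwartzMap.seminorm_le_bound' ℂ k m _ (by positivity) fun x => ?_
    rcases lt_or_ge |x| ((n : ℝ) + 1) with hx | hx
    · have h0 : (⇑(v n - u)) =ᶠ[nhds x] fun _ => 0 := by
        filter_upwards [(isOpen_lt continuous_abs continuous_const).mem_nhds hx] with y hy
        have hy : |y| < (n : ℝ) + 1 := hy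
        rw [_root_.sub_apply, hv, plateau_eq_one, one_mul, sub_self]
        rw [abs_mul, abs_of_pos hc0, hc, inv_mul_le_iff₀ hn]
        linarith
      rw [h0.iteratedDeriv_eq]
      have : iteratedDeriv m (fun _ : ℝ => (0 : ℂ)) x = 0 := by simp
      rw [this, norm_zero, mul_zero]
      positivity
    · have hρ : ContDiff ℝ m fun y : ℝ => plateau 2 (c * y) :=
        (contDiff_plateau (n := m) 2).comp (contDiff_const.mul contDiff_id)
      have hu : ContDiff ℝ m u := u.smooth m
      have h1 : (⇑(v n - u)) = (fun y => plateau 2 (c * y) * u y) - ⇑u := by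
        ext y; rw [_root_.sub_apply, hv]; rfl
      have h2 : ‖iteratedDeriv m (⇑(v n - u)) x‖ ≤ (∑ i ∈ Finset.range (m + 1),
          (m.choose i : ℝ) * R i * ‖iteratedDeriv (m - i) u x‖) + ‖iteratedDeriv m u x‖ := by
        rw [h1, iteratedDeriv_sub (hρ.mul hu).contDiffAt hu.contDiffAt]
        refine (norm_sub_le _ _).trans (add_le_add ?_ le_rfl)
        rw [← norm_iteratedFDeriv_eq_norm_iteratedDeriv]
        refine (norm_iteratedFDeriv_mul_le hρ hu x le_rfl).trans (Finset.sum_le_sum fun i hi => ?_)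
        rw [norm_iteratedFDeriv_eq_norm_iteratedDeriv, norm_iteratedFDeriv_eq_norm_iteratedDeriv]
        gcongr
        rw [iteratedDeriv_comp_const_smul (contDiff_plateau (n := i) 2), norm_smul, norm_pow,
          Real.norm_eq_abs, abs_of_pos hc0]
        calc _ ≤ 1 * ‖iteratedDeriv i (plateau 2) (c * x)‖ := by
              gcongr; exact pow_le_one₀ hc0.le hc1
          _ ≤ R i := by rw [one_mul]; exact hR _ _
      have h3 : ∀ l, |x| ^ (k + 1) * ‖iteratedDeriv l u x‖ ≤ SchwartzMap.seminorm ℂ (k + 1) l u :=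
        fun l => SchwartzMap.le_seminorm' ℂ (k + 1) l u x
      rw [le_div_iff₀ hn]
      calc |x| ^ k * ‖iteratedDeriv m (⇑(v n - u)) x‖ * ((n : ℝ) + 1)
          ≤ |x| ^ k * ‖iteratedDeriv m (⇑(v n - u)) x‖ * |x| := by gcongr
        _ = |x| ^ (k + 1) * ‖iteratedDeriv m (⇑(v n - u)) x‖ := by ring
        _ ≤ |x| ^ (k + 1) * ((∑ i ∈ Finset.range (m + 1),
          (m.choose i : ℝ) * R i * ‖iteratedDeriv (m - i) u x‖) + ‖iteratedDeriv m u x‖) := by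
            gcongr
        _ = |x| ^ (k + 1) * ‖iteratedDeriv m u x‖ + ∑ i ∈ Finset.range (m + 1),
          (m.choose i : ℝ) * R i * (|x| ^ (k + 1) * ‖iteratedDeriv (m - i) u x‖) := by
            rw [mul_add, Finset.mul_sum, add_comm]
            congr 1
            exact Finset.sum_congr rfl fun i _ => by ring
        _ ≤ M := by
            refine add_le_add (h3 m) (Finset.sum_le_sum fun i _ => ?_)
            exact mul_le_mul_of_nonneg_left (h3 _) (mul_nonneg (by positivity) (hR0 i))
  have hlim : Filter.Tendsto (fun n : ℕ => M / ((n : ℝ) + 1)) Filter.atTop (nhds 0) := by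
    simpa [div_eq_mul_inv] using tendsto_one_div_add_atTop_nhds_zero_nat.const_mul M
  filter_upwards [hlim.eventually (gt_mem_nhds hε)] with n hn
  exact (key n).trans_lt hn

/-- For a compactly supported test function, use a partition of unity subordinate to the open sets
on which `T` vanishes. -/
lemma temperedDistribution_apply_eq_zero_of_hasCompactSupport (T : 𝓢'(ℝ, ℂ)) (u : 𝓢(ℝ, ℂ))
    (hu : HasCompactSupport u) (hd : Disjoint (tsupport u) (Distribution.dsupport T)) :
    T u = 0 := by
  set ι := {s : Set ℝ // Distribution.IsVanishingOn T s ∧ IsOpen s}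
  have hcov : tsupport u ⊆ ⋃ i : ι, (i : Set ℝ) := by
    intro x hx
    have h1 : x ∉ Distribution.dsupport T := fun h => disjoint_left.1 hd hx h
    rw [Distribution.notMem_dsupport_iff] at h1
    obtain ⟨s, hs, hso, hxs⟩ := h1
    exact mem_iUnion.2 ⟨⟨s, hs, hso⟩, hxs⟩
  obtain ⟨ρ, hρ⟩ := SmoothPartitionOfUnity.exists_isSubordinate 𝓘(ℝ, ℝ)
    (isClosed_tsupport u) (fun i : ι => (i : Set ℝ)) (fun i => i.2.2) hcov
  have hfin := ρ.locallyFinite.finite_nonempty_inter_compact hu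
  set J := hfin.toFinset with hJ
  have hsm : ∀ i, ContDiff ℝ ∞ fun x => (ρ i x : ℂ) * u x := fun i =>
    (Complex.ofRealCLM.contDiff.comp (ρ i).contMDiff.contDiff).mul (u.smooth ⊤)
  have hcs : ∀ i, HasCompactSupport fun x => (ρ i x : ℂ) * u x := fun i => hu.mul_left
  have hsum : u = ∑ i ∈ J, (hcs i).toSchwartzMap (hsm i) := by
    ext x
    rw [_root_.sum_apply]
    simp only [HasCompactSupport.toSchwartzMap_toFun]
    rw [← Finset.sum_mul]
    by_cases hx : x ∈ tsupport u
    · have h2 : ∑ i ∈ J, ρ i x = 1 := by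
        refine ρ.sum_finsupport' _ hx fun i hi => ?_
        rw [hJ, Set.Finite.mem_toFinset]
        exact ⟨x, (ρ.mem_finsupport x).1 hi, hx⟩
      rw [← Complex.ofReal_sum, h2, Complex.ofReal_one, one_mul]
    · rw [image_eq_zero_of_notMem_tsupport hx, mul_zero]
  rw [hsum, map_sum]
  refine Finset.sum_eq_zero fun i _ => i.2.1 _ ?_
  refine subset_trans ?_ (hρ i)
  refine closure_mono fun x hx => ?_
  rw [Function.mem_support] at hx ⊢
  intro h
  apply hx
  simp [h]

/-- A tempered distribution annihilates every Schwartz function whose support is disjoint from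
its own; neither support needs to be compact. -/
lemma temperedDistribution_apply_eq_zero (T : 𝓢'(ℝ, ℂ)) (u : 𝓢(ℝ, ℂ))
    (hd : Disjoint (tsupport u) (Distribution.dsupport T)) : T u = 0 := by
  have hex : ∀ n : ℕ, ∃ v : 𝓢(ℝ, ℂ), ∀ x, v x = plateau 2 (((n : ℝ) + 1)⁻¹ * x) * u x := by
    intro n
    have hc : ((n : ℝ) + 1)⁻¹ ≠ 0 := inv_ne_zero (by positivity)
    have hcs := hasCompactSupport_plateau_mul 2 hc
    have hsm : ContDiff ℝ ∞ fun x : ℝ => plateau 2 (((n : ℝ) + 1)⁻¹ * x) :=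
      (contDiff_plateau_infty 2).comp (contDiff_const.mul contDiff_id)
    exact ⟨HasCompactSupport.toSchwartzMap (f := fun x => plateau 2 (((n : ℝ) + 1)⁻¹ * x) * u x)
      hcs.mul_right (hsm.mul (u.smooth ⊤)), fun x => rfl⟩
  choose v hv using hex
  have h2 := ((map_continuous T).tendsto u).comp (tendsto_plateau_smul_schwartz u v hv)
  have h3 : (T ∘ v) = fun _ => 0 := by
    ext n
    have hvn : ⇑(v n) = fun x => plateau 2 (((n : ℝ) + 1)⁻¹ * x) * u x := funext (hv n)
    refine temperedDistribution_apply_eq_zero_of_hasCompactSupport T _ ?_ (hd.mono_left ?_)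
    · rw [hvn]
      exact HasCompactSupport.mul_right
        (hasCompactSupport_plateau_mul 2 (inv_ne_zero (by positivity)))
    · rw [hvn]
      exact tsupport_mul_subset_right
  rw [h3] at h2
  exact tendsto_nhds_unique h2 tendsto_const_nhds

end Distributions

/-! ### The reproducing formula and dilations -/

section Reproducing
open scoped ContDiff

/-- A Fourier multiplier `χ` acts as the convolution with its inverse Fourier transform. -/
lemma fourier_mul_fourierInv_eq {χ : ℝ → ℂ} (hχ : Continuous χ) (hχc : HasCompactSupport χ)
    {K : ℝ → ℂ}
    (hK : ∀ t, K t = ∫ ξ : ℝ, χ ξ * Complex.exp (((2 * Real.pi * (t * ξ) : ℝ) : ℂ) * Complex.I))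
    (U : 𝓢(ℝ, ℂ)) (x : ℝ) :
    𝓕 (fun ξ => χ ξ * (𝓕⁻ U : 𝓢(ℝ, ℂ)) ξ) x = ∫ y, U y * K (y - x) := by
  have hχi : Integrable χ := hχ.integrable_of_hasCompactSupport hχc
  have hinv : ∀ ξ, (𝓕⁻ U : 𝓢(ℝ, ℂ)) ξ
      = ∫ y : ℝ, Complex.exp (((2 * Real.pi * (y * ξ) : ℝ) : ℂ) * Complex.I) * U y := by
    intro ξ
    rw [SchwartzMap.fourierInv_coe, Real.fourierInv_eq']
    refine integral_congr_ae (Filter.Eventually.of_forall fun y => ?_)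
    simp only [smul_eq_mul, RCLike.inner_apply, conj_trivial]
    rw [mul_comm ξ y]
  rw [Real.fourier_real_eq_integral_exp_smul]
  have h1 : ∀ ξ : ℝ, Complex.exp (((-2 * Real.pi * ξ * x : ℝ) : ℂ) * Complex.I) •
      (χ ξ * (𝓕⁻ U : 𝓢(ℝ, ℂ)) ξ) = ∫ y : ℝ, U y *
        (χ ξ * Complex.exp (((2 * Real.pi * ((y - x) * ξ) : ℝ) : ℂ) * Complex.I)) := by
    intro ξ
    rw [hinv, smul_eq_mul, ← mul_assoc, ← integral_const_mul]
    refine integral_congr_ae (Filter.Eventually.of_forall fun y => ?_)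
    have : Complex.exp (((2 * Real.pi * ((y - x) * ξ) : ℝ) : ℂ) * Complex.I)
        = Complex.exp (((-2 * Real.pi * ξ * x : ℝ) : ℂ) * Complex.I)
          * Complex.exp (((2 * Real.pi * (y * ξ) : ℝ) : ℂ) * Complex.I) := by
      rw [← Complex.exp_add]; congr 1; push_cast; ring
    simp only [this]
    ring
  simp_rw [h1]
  rw [integral_integral_swap]
  · refine integral_congr_ae (Filter.Eventually.of_forall fun y => ?_)
    simp only
    rw [integral_const_mul, ← hK]
  · refine (hχi.norm.mul_prod U.integrable.norm).mono' ?_ (Filter.Eventually.of_forall fun q => ?_)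
    · refine Continuous.aestronglyMeasurable ?_
      have := U.continuous
      simp only [Function.uncurry_def]
      fun_prop
    · simp only [Function.uncurry_def]
      rw [norm_mul, norm_mul, Complex.norm_exp_ofReal_mul_I, mul_one, mul_comm]

lemma continuous_integral_mul_comp_sub {p : ℝ≥0∞} (hp : 1 ≤ p) {f : ℝ → ℂ}
    (hf : MemLp f p volume) {K : ℝ → ℂ} (hKc : Continuous K) {C : ℝ} (hC : 0 ≤ C)
    (hKC : ∀ t, ‖K t‖ ≤ C * (1 + t ^ 2)⁻¹) : Continuous fun y => ∫ x, f x * K (y - x) := by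
  rw [continuous_iff_continuousAt]
  intro y₀
  refine continuousAt_of_dominated
    (bound := fun x => 2 * (1 + 1 ^ 2) * C * ((1 + (y₀ - x) ^ 2)⁻¹ * ‖f x‖))
    (Filter.Eventually.of_forall fun y =>
      hf.1.mul (hKc.comp (continuous_const.sub continuous_id)).aestronglyMeasurable) ?_
    ((integrable_weight_mul hp hf y₀).const_mul _)
    (Filter.Eventually.of_forall fun x =>
      (continuous_const.mul (hKc.comp (continuous_id.sub continuous_const))).continuousAt)
  filter_upwards [Metric.ball_mem_nhds y₀ one_pos] with y hy
  refine Filter.Eventually.of_forall fun x => ?_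
  rw [Metric.mem_ball, Real.dist_eq] at hy
  have h1 := mul_le_mul_of_nonneg_left (inv_one_add_sub_sq_le (s := x) hy.le) hC
  rw [norm_mul]
  calc ‖f x‖ * ‖K (y - x)‖ ≤ ‖f x‖ * (C * (2 * (1 + 1 ^ 2) * (1 + (y₀ - x) ^ 2)⁻¹)) := by
        gcongr; exact (hKC _).trans h1
    _ = _ := by ring

/-- A function in `L^p` is reproduced by the convolution with the inverse Fourier transform of any
test function that is `1` near the support of its Fourier transform. -/
lemma ae_eq_integral_mul_comp_sub {p : ℝ≥0∞} [hp : Fact (1 ≤ p)] (f : Lp ℂ p (volume : Measure ℝ))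
    {χ : ℝ → ℂ} (hχ : ContDiff ℝ ∞ χ) (hχc : HasCompactSupport χ) {V : Set ℝ} (hV : IsOpen V)
    (hχV : ∀ ξ ∈ V, χ ξ = 1)
    (hfV : Distribution.dsupport (𝓕 (f : 𝓢'(ℝ, ℂ)) : 𝓢'(ℝ, ℂ)) ⊆ V) {K : ℝ → ℂ}
    (hK : ∀ t, K t = ∫ ξ : ℝ, χ ξ * Complex.exp (((2 * Real.pi * (t * ξ) : ℝ) : ℂ) * Complex.I))
    (hKc : Continuous K) {C : ℝ} (hC : 0 ≤ C) (hKC : ∀ t, ‖K t‖ ≤ C * (1 + t ^ 2)⁻¹) :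
    ∀ᵐ y, f y = ∫ x, f x * K (y - x) := by
  have hf := Lp.memLp f
  refine ae_eq_of_integral_contDiff_smul_eq (hf.locallyIntegrable hp.out)
    (continuous_integral_mul_comp_sub hp.out hf hKc hC hKC).locallyIntegrable fun u hu huc => ?_
  have hUs : ContDiff ℝ ∞ fun y => (u y : ℂ) := Complex.ofRealCLM.contDiff.comp hu
  -- test against `u`; `h - w = (1 - χ) 𝓕⁻ u` vanishes on the neighbourhood `V` of the spectrum
  have hUc : HasCompactSupport fun y => (u y : ℂ) := huc.comp_left Complex.ofReal_zero
  set U : 𝓢(ℝ, ℂ) := hUc.toSchwartzMap hUs with hU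
  have hUu : ∀ y, U y = (u y : ℂ) := fun y => rfl
  set h : 𝓢(ℝ, ℂ) := 𝓕⁻ U with hh
  obtain ⟨w, hw⟩ : ∃ w : 𝓢(ℝ, ℂ), ∀ ξ, w ξ = χ ξ * h ξ :=
    ⟨HasCompactSupport.toSchwartzMap (f := fun ξ => χ ξ * h ξ) hχc.mul_right
      (hχ.mul (h.smooth ⊤)), fun ξ => rfl⟩
  have hT : (𝓕 (f : 𝓢'(ℝ, ℂ)) : 𝓢'(ℝ, ℂ)) (h - w) = 0 := by
    refine temperedDistribution_apply_eq_zero _ _ (disjoint_of_subset_right hfV ?_)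
    rw [disjoint_comm, ← subset_compl_iff_disjoint_left]
    refine closure_minimal (fun ξ hξ hξV => hξ ?_) hV.isClosed_compl
    rw [_root_.sub_apply, hw, hχV ξ hξV, one_mul, sub_self]
  rw [map_sub, sub_eq_zero, TemperedDistribution.fourier_apply, TemperedDistribution.fourier_apply,
    Lp.toTemperedDistribution_apply, Lp.toTemperedDistribution_apply, hh,
    FourierTransform.fourier_fourierInv_eq] at hT
  have hw' : ∀ x, (𝓕 w : 𝓢(ℝ, ℂ)) x = ∫ y, U y * K (y - x) := by
    intro x
    rw [SchwartzMap.fourier_coe, show (⇑w) = fun ξ => χ ξ * h ξ from funext hw]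
    exact fourier_mul_fourierInv_eq hχ.continuous hχc hK U x
  calc ∫ y, u y • f y = ∫ y, U y • f y := by
        refine integral_congr_ae (Filter.Eventually.of_forall fun y => ?_)
        simp [hUu]
    _ = ∫ x, (∫ y, U y * K (y - x)) • f x := by rw [hT]; simp_rw [hw']
    _ = ∫ x, ∫ y, U y * (f x * K (y - x)) := by
        refine integral_congr_ae (Filter.Eventually.of_forall fun x => ?_)
        simp only
        rw [smul_eq_mul, ← integral_mul_const]
        refine integral_congr_ae (Filter.Eventually.of_forall fun y => ?_)
        simp only
        ring
    _ = ∫ y, ∫ x, U y * (f x * K (y - x)) := by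
        refine integral_integral_swap ?_
        have hUw : Integrable fun y : ℝ => 2 * (1 + |y| ^ 2) * C * ‖U y‖ := by
          refine Continuous.integrable_of_hasCompactSupport ?_ ?_
          · have := U.continuous
            fun_prop
          · exact (HasCompactSupport.norm (f := U) hUc).mul_left
        refine ((integrable_weight_mul hp.out hf 0).mul_prod hUw).mono' ?_
          (Filter.Eventually.of_forall fun q => ?_)
        · have h1 : AEStronglyMeasurable (fun q : ℝ × ℝ => f q.1) (volume.prod volume) :=
            hf.1.comp_fst
          have h2 : Continuous fun q : ℝ × ℝ => U q.2 := U.continuous.comp continuous_snd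
          have h3 : Continuous fun q : ℝ × ℝ => K (q.2 - q.1) :=
            hKc.comp (continuous_snd.sub continuous_fst)
          exact h2.aestronglyMeasurable.mul (h1.mul h3.aestronglyMeasurable)
        · simp only [Function.uncurry_def]
          rw [norm_mul, norm_mul]
          have h1 := inv_one_add_sub_sq_le (u := q.2) (x := 0) (s := q.1) (R := |q.2|) (by simp)
          calc _ ≤ ‖U q.2‖ * (‖f q.1‖ * (C * (2 * (1 + |q.2| ^ 2) * (1 + (0 - q.1) ^ 2)⁻¹))) := by
                gcongr
                exact (hKC _).trans (mul_le_mul_of_nonneg_left h1 hC)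
            _ = _ := by ring
    _ = ∫ y, u y • ∫ x, f x * K (y - x) := by
        refine integral_congr_ae (Filter.Eventually.of_forall fun y => ?_)
        simp only
        rw [integral_const_mul, hUu, Complex.real_smul]

end Reproducing

section Scaling

lemma map_mul_left_volume {a : ℝ} (ha : 0 < a) :
    Measure.map (fun x => a * x) volume = ENNReal.ofReal a⁻¹ • (volume : Measure ℝ) := by
  rw [Real.map_volume_mul_left ha.ne', abs_of_pos (inv_pos.2 ha)]

lemma measurableEmbedding_mul_left {a : ℝ} (ha : 0 < a) :
    MeasurableEmbedding fun x : ℝ => a * x :=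
  measurableEmbedding_mulLeft₀ ha.ne'

lemma eLpNorm_comp_mul_left_restrict {a : ℝ} (ha : 0 < a) (f : ℝ → ℂ) (p : ℝ≥0∞) (E : Set ℝ) :
    eLpNorm (fun t => f (a * t)) p (volume.restrict ((fun t => a * t) ⁻¹' E))
      = ENNReal.ofReal a⁻¹ ^ (1 / p).toReal * eLpNorm f p (volume.restrict E) := by
  have h := (measurableEmbedding_mul_left ha).eLpNorm_map_measure (g := f) (p := p)
    (μ := volume.restrict ((fun t => a * t) ⁻¹' E))
  rw [← (measurableEmbedding_mul_left ha).restrict_map, map_mul_left_volume ha,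
    Measure.restrict_smul, eLpNorm_smul_measure_of_ne_zero (by simpa using ha), smul_eq_mul] at h
  exact h.symm

lemma isThick_preimage_mul_left {a γ : ℝ} (ha : 0 < a) {E : Set ℝ} (hE : IsThick a γ E) :
    IsThick 1 γ ((fun t => a * t) ⁻¹' E) := by
  refine ⟨hE.1.preimage ?_, fun x => ?_⟩
  · refine ⟨measurable_const_mul a, ?_⟩
    rw [map_mul_left_volume ha]
    exact Measure.smul_absolutelyContinuous
  · have h1 := hE.2 (a * x)
    have h2 : (fun t => a * t) ⁻¹' E ∩ Icc x (x + 1)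
        = (fun t => a * t) ⁻¹' (E ∩ Icc (a * x) (a * x + a)) := by
      ext t
      simp only [mem_inter_iff, mem_preimage, mem_Icc]
      rw [mul_le_mul_iff_right₀ ha, show a * x + a = a * (x + 1) by ring, mul_le_mul_iff_right₀ ha]
    rw [h2, Real.volume_preimage_mul_left ha.ne', abs_of_pos (inv_pos.2 ha), mul_one]
    calc ENNReal.ofReal γ = ENNReal.ofReal a⁻¹ * ENNReal.ofReal (γ * a) := by
          rw [← ENNReal.ofReal_mul (inv_pos.2 ha).le]; congr 1; field_simp
      _ ≤ _ := by gcongr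

end Scaling

/-! ### The Logvinenko–Sereda inequality -/

/-- The inverse Fourier transform of a plateau of half-width `B`, dilated by `2πa` and centred at
the frequency `ω`. -/
lemma integral_plateau_mul_exp {a : ℝ} (ha : 0 < a) (B ω t : ℝ) :
    ∫ ξ : ℝ, plateau B (a * (2 * Real.pi * ξ - ω)) *
        Complex.exp (((2 * Real.pi * (t * ξ) : ℝ) : ℂ) * Complex.I)
      = Complex.exp (((ω * t : ℝ) : ℂ) * Complex.I) * ((2 * Real.pi * a)⁻¹ : ℝ) *
          fourierLaplace (plateau B) ((t / a : ℝ) : ℂ) := by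
  have hpa : 0 < 2 * Real.pi * a := by positivity
  set G : ℝ → ℂ := fun s => plateau B s *
    Complex.exp (Complex.I * ((t / a : ℝ) : ℂ) * s) with hG
  have h1 : ∀ ξ : ℝ, plateau B (a * (2 * Real.pi * ξ - ω)) *
        Complex.exp (((2 * Real.pi * (t * ξ) : ℝ) : ℂ) * Complex.I)
      = Complex.exp (((ω * t : ℝ) : ℂ) * Complex.I) * G (2 * Real.pi * a * ξ - a * ω) := by
    intro ξ
    have h2 : a * (2 * Real.pi * ξ - ω) = 2 * Real.pi * a * ξ - a * ω := by ring
    have h3 : Complex.exp (((2 * Real.pi * (t * ξ) : ℝ) : ℂ) * Complex.I)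
        = Complex.exp (((ω * t : ℝ) : ℂ) * Complex.I) *
          Complex.exp (Complex.I * ((t / a : ℝ) : ℂ) * ((2 * Real.pi * a * ξ - a * ω : ℝ) : ℂ)) := by
      rw [← Complex.exp_add]
      congr 1
      have : (a : ℂ) ≠ 0 := by exact_mod_cast ha.ne'
      push_cast
      field_simp
      ring
    rw [h2, h3, hG]
    ring
  simp_rw [h1]
  rw [integral_const_mul, Measure.integral_comp_mul_left (fun s => G (s - a * ω)),
    integral_sub_right_eq_self, abs_of_pos (inv_pos.2 hpa), Complex.real_smul, ← mul_assoc]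
  rfl

/-- The Logvinenko–Sereda inequality with an explicit exponent, for a bound `D` of the plateau
kernels. -/
lemma logvinenko_sereda_aux {D : ℝ} (hD1 : 1 ≤ D)
    (hD : ∀ b : ℝ, 0 ≤ b → ∀ z : ℂ,
      ‖fourierLaplace (plateau b) z‖ ≤ 4 * b * D * Real.exp (b * |z.im|) * (1 + z.re ^ 2)⁻¹)
    {p : ℝ≥0∞} [hp : Fact (1 ≤ p)] {a b c γ : ℝ} {E : Set ℝ} (f : Lp ℂ p (volume : Measure ℝ))
    (ha : 0 < a) (hb : 0 ≤ b) (hγ : 0 < γ) (hE : IsThick a γ E)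
    (hf : fourierSupport f ⊆ Icc c (c + b)) {N : ℕ} (hN : 1 ≤ N)
    (hDN : 416 * D * Real.exp (7 * (a * b / 2 + 2)) ≤ 3 ^ (N + 1)) :
    ENNReal.ofReal ((γ / 28) ^ (N + 1)) * eLpNorm f p volume
      ≤ eLpNorm f p (volume.restrict E) := by
  have hfm := Lp.memLp f
  -- after the dilation by `a` the spectrum lies in `[-(a b / 2), a b / 2]`, well inside the
  -- interval `[-(B - 1), B - 1]` on which the plateau is `1`
  set B := a * b / 2 + 2 with hB
  have hB2 : 2 ≤ B := by have := mul_nonneg ha.le hb; linarith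
  have hB0 : 0 ≤ B := by linarith
  set ω := c + b / 2 with hω
  set κ : ℂ → ℂ := fun z => ((2 * Real.pi)⁻¹ : ℝ) * fourierLaplace (plateau B) z with hκ
  have hplc : Continuous (plateau B) := (contDiff_plateau (n := 0) B).continuous
  have hκd : Differentiable ℂ κ :=
    (differentiable_fourierLaplace hplc fun _ => plateau_eq_zero).const_mul _
  set L := (2 * Real.pi)⁻¹ * (4 * B * D * Real.exp (B * 6)) with hL
  have hL0 : 0 < L := by positivity
  have hκL : ∀ z : ℂ, |z.im| ≤ 6 → ‖κ z‖ ≤ L * (1 + z.re ^ 2)⁻¹ := by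
    intro z hz
    rw [hκ, hL]
    simp only [norm_mul, Complex.norm_real, Real.norm_eq_abs]
    rw [abs_of_pos (by positivity), mul_assoc]
    refine mul_le_mul_of_nonneg_left ((hD B hB0 z).trans ?_) (by positivity)
    gcongr
  -- the multiplier `χ` is `1` near the Fourier support of `f`, and `K` is its kernel
  set χ : ℝ → ℂ := fun ξ => plateau B (a * (2 * Real.pi * ξ - ω)) with hχ
  set K : ℝ → ℂ := fun t => Complex.exp (((ω * t : ℝ) : ℂ) * Complex.I) * ((a⁻¹ : ℝ) : ℂ) *
    κ ((t / a : ℝ) : ℂ) with hKdef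
  have hχs : ContDiff ℝ ((⊤ : ℕ∞) : WithTop ℕ∞) χ :=
    (contDiff_plateau B).comp
      (contDiff_const.mul ((contDiff_const.mul contDiff_id).sub contDiff_const))
  have hχc : HasCompactSupport χ := by
    refine HasCompactSupport.intro (isCompact_Icc (a := (ω - B / a) / (2 * Real.pi))
      (b := (ω + B / a) / (2 * Real.pi))) fun ξ hξ => plateau_eq_zero fun h => hξ ?_
    have h1 : 2 * Real.pi * ξ - ω ≤ B / a := by rw [le_div_iff₀' ha]; exact h.2
    have h2 : -(B / a) ≤ 2 * Real.pi * ξ - ω := by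
      rw [← neg_div, div_le_iff₀' ha]; exact h.1
    constructor
    · rw [div_le_iff₀ (by positivity)]; linarith
    · rw [le_div_iff₀ (by positivity)]; linarith
  have hK : ∀ t, K t = ∫ ξ : ℝ, χ ξ *
      Complex.exp (((2 * Real.pi * (t * ξ) : ℝ) : ℂ) * Complex.I) := by
    intro t
    rw [hχ, integral_plateau_mul_exp ha B ω t, hKdef, hκ]
    push_cast
    rw [mul_inv]
    ring
  have hKc : Continuous K := by
    have := hκd.continuous
    fun_prop
  have hKC : ∀ t, ‖K t‖ ≤ a⁻¹ * L * (1 + a ^ 2) * (1 + t ^ 2)⁻¹ := by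
    intro t
    have h1 := hκL ((t / a : ℝ) : ℂ) (by simp)
    have h0 : ‖K t‖ = a⁻¹ * ‖κ ((t / a : ℝ) : ℂ)‖ := by
      rw [hKdef, norm_mul, norm_mul, Complex.norm_exp_ofReal_mul_I, one_mul, Complex.norm_real,
        Real.norm_eq_abs, abs_of_pos (inv_pos.2 ha)]
    rw [h0, mul_assoc, mul_assoc]
    refine mul_le_mul_of_nonneg_left (h1.trans (mul_le_mul_of_nonneg_left ?_ hL0.le))
      (inv_pos.2 ha).le
    rw [Complex.ofReal_re, ← div_eq_mul_inv, inv_le_comm₀ (by positivity) (by positivity), inv_div,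
      div_le_iff₀ (by positivity), div_pow]
    have h2 : t ^ 2 / a ^ 2 * a ^ 2 = t ^ 2 := by field_simp
    have h3 : 0 ≤ t ^ 2 / a ^ 2 := by positivity
    nlinarith [sq_nonneg a]
  have hV : IsOpen {ξ : ℝ | |a * (2 * Real.pi * ξ - ω)| < B - 1} :=
    isOpen_lt (by fun_prop) continuous_const
  have hfV : Distribution.dsupport (𝓕 (f : 𝓢'(ℝ, ℂ)) : 𝓢'(ℝ, ℂ))
      ⊆ {ξ : ℝ | |a * (2 * Real.pi * ξ - ω)| < B - 1} := by
    intro ξ hξ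
    have h1 : 2 * Real.pi * ξ ∈ Icc c (c + b) := hf ⟨ξ, hξ, rfl⟩
    change |a * (2 * Real.pi * ξ - ω)| < B - 1
    rw [abs_mul, abs_of_pos ha]
    have h2 : |2 * Real.pi * ξ - ω| ≤ b / 2 := by
      rw [abs_le]; constructor <;> linarith [h1.1, h1.2]
    nlinarith
  have hrep := ae_eq_integral_mul_comp_sub f hχs hχc hV
    (fun ξ hξ => plateau_eq_one (le_of_lt hξ)) hfV hK hKc (by positivity) hKC
  -- pass to `g`, with unit spacing and Fourier support centred at `0`
  set g : ℝ → ℂ := fun s => Complex.exp (((-(ω * a * s) : ℝ) : ℂ) * Complex.I) * f (a * s) with hg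
  have hgn : ∀ s, ‖g s‖ = ‖f (a * s)‖ := fun s => by
    rw [hg]; simp only [norm_mul, Complex.norm_exp_ofReal_mul_I, one_mul]
  set F : ℂ → ℂ := fun z => ∫ s : ℝ, g s * κ (z - s) with hF
  have hqmp : Measure.QuasiMeasurePreserving (fun t : ℝ => a * t) volume volume := by
    refine ⟨measurable_const_mul a, ?_⟩
    rw [map_mul_left_volume ha]
    exact Measure.smul_absolutelyContinuous
  have hgF : ∀ᵐ t : ℝ, g t = F t := by
    filter_upwards [hqmp.ae hrep] with t ht
    rw [hg]
    simp only
    rw [ht]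
    set H : ℝ → ℂ := fun s => (a⁻¹ : ℝ) •
        (Complex.exp (((ω * a * (t - s) : ℝ) : ℂ) * Complex.I) * (f (a * s) *
          κ (t - s))) with hH
    have h1 : ∀ x : ℝ, f x * K (a * t - x) = H (x / a) := by
      intro x
      have e1 : a * (x / a) = x := by field_simp
      have e2 : (a * t - x) / a = t - x / a := by field_simp
      have e3 : ω * (a * t - x) = ω * a * (t - x / a) := by field_simp
      simp only [hKdef, hH]
      rw [e1, e2, e3, Complex.real_smul, Complex.ofReal_sub t]
      ring
    simp_rw [h1]
    rw [Measure.integral_comp_div H, abs_of_pos ha, hH, integral_smul, smul_smul,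
      mul_inv_cancel₀ ha.ne', one_smul, ← integral_const_mul, hF]
    refine integral_congr_ae (Filter.Eventually.of_forall fun s => ?_)
    have e4 : Complex.exp (((-(ω * a * s) : ℝ) : ℂ) * Complex.I)
        = Complex.exp (((-(ω * a * t) : ℝ) : ℂ) * Complex.I) *
          Complex.exp (((ω * a * (t - s) : ℝ) : ℂ) * Complex.I) := by
      rw [← Complex.exp_add]; congr 1; push_cast; ring
    simp only [hg]
    rw [e4]
    ring
  have hnorm : ∀ E' : Set ℝ, eLpNorm (fun t : ℝ => F t) p
        (volume.restrict ((fun t => a * t) ⁻¹' E'))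
      = ENNReal.ofReal a⁻¹ ^ (1 / p).toReal * eLpNorm f p (volume.restrict E') := by
    intro E'
    rw [← eLpNorm_comp_mul_left_restrict ha, ← eLpNorm_congr_ae (ae_restrict_of_ae hgF)]
    exact eLpNorm_congr_norm_ae (Filter.Eventually.of_forall hgn)
  have hnorm' : eLpNorm (fun t : ℝ => F t) p volume
      = ENNReal.ofReal a⁻¹ ^ (1 / p).toReal * eLpNorm f p volume := by
    have := hnorm univ
    rwa [preimage_univ, Measure.restrict_univ] at this
  have hs0 : ENNReal.ofReal a⁻¹ ^ (1 / p).toReal ≠ 0 := by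
    rw [Ne, ENNReal.rpow_eq_zero_iff]
    simp [ha]
  have hst : ENNReal.ofReal a⁻¹ ^ (1 / p).toReal ≠ ∞ :=
    ENNReal.rpow_ne_top_of_nonneg ENNReal.toReal_nonneg ENNReal.ofReal_ne_top
  have hgm : MemLp g p volume := by
    refine ⟨?_, ?_⟩
    · have h1 : AEStronglyMeasurable (fun s => f (a * s)) volume :=
        hfm.1.comp_quasiMeasurePreserving hqmp
      exact (by fun_prop : Continuous fun s : ℝ =>
        Complex.exp (((-(ω * a * s) : ℝ) : ℂ) * Complex.I)).aestronglyMeasurable.mul h1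
    · rw [eLpNorm_congr_ae hgF, hnorm']
      exact ENNReal.mul_lt_top hst.lt_top hfm.2
  have hFd := differentiableOn_integral_mul_kernel hκd hL0.le hκL hp.out hgm
  have hFΛ : ∀ x : ℝ, ∀ z ∈ Metric.closedBall (x : ℂ) 5,
      ‖F z‖ₑ ≤ weightedMean (52 * L) (fun t => F t) x := by
    intro x z hz
    refine (enorm_integral_mul_kernel_le hL0.le hκL hz).trans (le_of_eq ?_)
    refine lintegral_congr_ae ?_
    filter_upwards [hgF] with s hs
    rw [hs]
  have hΛN : 4 * (Real.pi * (52 * L)) ≤ 3 ^ (N + 1) := by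
    refine le_trans ?_ hDN
    have h1 : B ≤ Real.exp B := by linarith [Real.add_one_le_exp B]
    calc 4 * (Real.pi * (52 * L)) = 416 * D * (B * Real.exp (B * 6)) := by
          rw [hL, mul_inv]
          have := Real.pi_ne_zero
          field_simp
          ring
      _ ≤ 416 * D * (Real.exp B * Real.exp (B * 6)) := by gcongr
      _ = _ := by rw [← Real.exp_add]; congr 2; ring
  have hmain := pow_mul_eLpNorm_le hFd (by positivity) hFΛ hγ (isThick_preimage_mul_left ha hE)
    hN hΛN hp.out (by rw [hnorm']; exact ENNReal.mul_ne_top hst hfm.2.ne)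
  rw [hnorm, hnorm', mul_left_comm] at hmain
  exact (ENNReal.mul_le_mul_iff_right hs0 hst).1 hmain

/-- The Logvinenko–Sereda inequality. Any `N ≥ log (416 D) + 7 (a b / 2 + 2)` is admissible in
`logvinenko_sereda_aux`, since `e < 3`. -/
theorem exists_logvinenko_sereda :
    ∃ C : ℝ, 0 < C ∧
      ∀ (p : ℝ≥0∞) [Fact (1 ≤ p)] (a b c γ : ℝ) (E : Set ℝ) (f : Lp ℂ p (volume : Measure ℝ)),
        0 < a → 0 ≤ b → 0 < γ → IsThick a γ E → fourierSupport f ⊆ Icc c (c + b) →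
        ENNReal.ofReal ((γ / C) ^ (C * (a * b + 1))) * eLpNorm f p volume
          ≤ eLpNorm f p (volume.restrict E) := by
  obtain ⟨D, hD1, hD⟩ := exists_norm_fourierLaplace_plateau_le
  have hlog : 0 ≤ Real.log (416 * D) := Real.log_nonneg (by linarith)
  set C := Real.log (416 * D) + 28 with hC
  have hC0 : 0 < C := by linarith
  refine ⟨C, hC0, fun p _ a b c γ E f ha hb hγ hE hf => ?_⟩
  have hγ1 := hE.le_one ha
  have hab : 0 ≤ a * b := mul_nonneg ha.le hb
  set r := Real.log (416 * D) + 7 * (a * b / 2 + 2) with hr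
  have hr14 : 14 ≤ r := by linarith
  set N := ⌈r⌉₊ with hN
  have hrN : r ≤ N := Nat.le_ceil r
  have hNr : (N : ℝ) < r + 1 := Nat.ceil_lt_add_one (by linarith)
  have hN1 : 1 ≤ N := by
    have : (1 : ℝ) ≤ N := by linarith
    exact_mod_cast this
  have hDN : 416 * D * Real.exp (7 * (a * b / 2 + 2)) ≤ 3 ^ (N + 1) := by
    calc 416 * D * Real.exp (7 * (a * b / 2 + 2)) = Real.exp r := by
          rw [hr, Real.exp_add, Real.exp_log (by linarith)]
      _ ≤ Real.exp (N * 1) := Real.exp_le_exp.2 (by linarith)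
      _ = Real.exp 1 ^ N := Real.exp_nat_mul 1 N
      _ ≤ 3 ^ N := pow_le_pow_left₀ (Real.exp_pos _).le Real.exp_one_lt_three.le N
      _ ≤ 3 ^ (N + 1) := pow_le_pow_right₀ (by norm_num) (by omega)
  refine le_trans ?_ (logvinenko_sereda_aux hD1 hD f ha hb hγ hE hf hN1 hDN)
  gcongr
  have hexp : ((N + 1 : ℕ) : ℝ) ≤ C * (a * b + 1) := by
    push_cast
    nlinarith [mul_nonneg hlog hab]
  calc (γ / C) ^ (C * (a * b + 1)) ≤ (γ / 28) ^ (C * (a * b + 1)) := by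
        refine Real.rpow_le_rpow (by positivity) ?_ (by positivity)
        gcongr
        linarith
    _ ≤ (γ / 28) ^ ((N + 1 : ℕ) : ℝ) :=
        Real.rpow_le_rpow_of_exponent_ge (by positivity) (by linarith) hexp
    _ = _ := Real.rpow_natCast _ _

/-! ### The extremal example -/

section ExampleSet

lemma measurableSet_exampleSet (γ : ℝ) : MeasurableSet (exampleSet γ) := by
  have : exampleSet γ = ⋃ k : ℤ, (fun x : ℝ => x + k) ⁻¹'
      (Icc (-(1 / 2) : ℝ) (-(1 / 2) + γ / 2) ∪ Icc (1 / 2 - γ / 2) (1 / 2)) := by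
    ext x
    rw [mem_iUnion]
    rfl
  rw [this]
  exact MeasurableSet.iUnion fun k =>
    (measurable_add_const _) (measurableSet_Icc.union measurableSet_Icc)

/-- By periodicity every interval of length `1` may be replaced by `(-1/2, 1/2]`. -/
lemma isThick_exampleSet {γ : ℝ} (hγ : 0 < γ) (hγ1 : γ ≤ 1) : IsThick 1 γ (exampleSet γ) := by
  refine ⟨(measurableSet_exampleSet γ).nullMeasurableSet, fun x => ?_⟩
  have hinv : ∀ g : AddSubgroup.zmultiples (1 : ℝ), (fun x => g +ᵥ x) ⁻¹' exampleSet γ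
      = exampleSet γ := by
    rintro ⟨_, m, rfl⟩
    ext y
    have h1 : ∀ k : ℤ, (m • (1 : ℝ) + y) + k = y + ((k + m : ℤ) : ℝ) := fun k => by
      push_cast; simp; ring
    constructor
    · rintro ⟨k, hk⟩
      exact ⟨k + m, by rw [← h1]; exact hk⟩
    · rintro ⟨k, hk⟩
      refine ⟨k - m, ?_⟩
      change (m • (1 : ℝ) + y) + ((k - m : ℤ) : ℝ) ∈ _
      rw [h1, sub_add_cancel]
      exact hk
  have h := (isAddFundamentalDomain_Ioc (one_pos (α := ℝ)) x).measure_set_eq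
    (isAddFundamentalDomain_Ioc (one_pos (α := ℝ)) (-(1 / 2))) (measurableSet_exampleSet γ) hinv
  calc ENNReal.ofReal (γ * 1)
      = volume (Ioc (-(1 / 2) : ℝ) (-(1 / 2) + γ / 2) ∪ Ioc (1 / 2 - γ / 2) (1 / 2)) := by
        rw [measure_union _ measurableSet_Ioc, Real.volume_Ioc, Real.volume_Ioc,
          ← ENNReal.ofReal_add (by linarith) (by linarith)]
        · congr 1; ring
        · rw [disjoint_left]
          intro y hy hy'
          linarith [hy.2, hy'.1]
    _ ≤ volume (exampleSet γ ∩ Ioc (-(1 / 2)) (-(1 / 2) + 1)) := by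
        refine measure_mono ?_
        rintro y (hy | hy)
        · refine ⟨⟨0, Or.inl ?_⟩, hy.1, by linarith [hy.2]⟩
          rw [Int.cast_zero, add_zero]
          exact ⟨hy.1.le, hy.2⟩
        · refine ⟨⟨0, Or.inr ?_⟩, by linarith [hy.1], by linarith [hy.2]⟩
          rw [Int.cast_zero, add_zero]
          exact ⟨hy.1.le, hy.2⟩
    _ = volume (exampleSet γ ∩ Ioc x (x + 1)) := h.symm
    _ ≤ _ := measure_mono (inter_subset_inter_right _ Ioc_subset_Icc_self)

lemma quarter_le_abs_of_mem_exampleSet {γ x : ℝ} (hγ : γ ≤ 1 / 2) (hx : x ∈ exampleSet γ) :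
    1 / 4 ≤ |x| := by
  obtain ⟨k, hk⟩ := hx
  by_contra h
  rw [not_le, abs_lt] at h
  have hk1 : (-1 : ℝ) < k := by rcases hk with hk | hk <;> linarith [hk.1, h.1, h.2]
  have hk2 : (k : ℝ) < 1 := by rcases hk with hk | hk <;> linarith [hk.2, h.1, h.2]
  have hk0 : k = 0 := by
    have h1 : -1 < k := by exact_mod_cast hk1
    have h2 : k < 1 := by exact_mod_cast hk2
    omega
  rw [hk0, Int.cast_zero, add_zero] at hk
  rcases hk with hk | hk
  · linarith [hk.2, h.1]
  · linarith [hk.1, h.2]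

lemma abs_sin_le_of_mem_exampleSet {γ x : ℝ} (hx : x ∈ exampleSet γ) :
    |Real.sin (2 * Real.pi * x)| ≤ Real.pi * γ := by
  obtain ⟨k, hk⟩ := hx
  have hπ := Real.pi_pos
  have h1 : Real.sin (2 * Real.pi * x) = Real.sin (2 * Real.pi * (x + k)) := by
    rw [← Real.sin_add_int_mul_two_pi _ k]; congr 1; ring
  rw [h1]
  set y := x + (k : ℝ) with hy
  rcases hk with hk | hk
  · have h2 : Real.sin (2 * Real.pi * y) = -Real.sin (2 * Real.pi * (y + 1 / 2)) := by
      rw [show 2 * Real.pi * (y + 1 / 2) = 2 * Real.pi * y + Real.pi by ring, Real.sin_add_pi,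
        neg_neg]
    rw [h2, abs_neg]
    refine Real.abs_sin_le_abs.trans ?_
    have h3 : 0 ≤ y + 1 / 2 := by linarith [hk.1]
    rw [abs_of_nonneg (by positivity)]
    nlinarith [hk.2]
  · have h2 : Real.sin (2 * Real.pi * y) = Real.sin (2 * Real.pi * (1 / 2 - y)) := by
      rw [show 2 * Real.pi * (1 / 2 - y) = Real.pi - 2 * Real.pi * y by ring, Real.sin_pi_sub]
    rw [h2]
    refine Real.abs_sin_le_abs.trans ?_
    have h3 : 0 ≤ 1 / 2 - y := by linarith [hk.2]
    rw [abs_of_nonneg (by positivity)]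
    nlinarith [hk.1]

end ExampleSet

section ExampleFun

/-- Both sides vanish at `x = 0`, so no exception is needed there. -/
lemma two_pi_sinc_mul (x : ℝ) :
    2 * Real.pi * Real.sinc (2 * Real.pi * x) * x = Real.sin (2 * Real.pi * x) := by
  rcases eq_or_ne x 0 with rfl | hx
  · simp
  · rw [Real.sinc_of_ne_zero (mul_ne_zero (by positivity) hx)]
    have := Real.pi_ne_zero
    field_simp

lemma norm_exampleFun (b x : ℝ) :
    ‖exampleFun b x‖ = |2 * Real.pi * Real.sinc (2 * Real.pi * x)| ^ ⌊b / (4 * Real.pi)⌋₊ := by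
  rw [exampleFun, Complex.norm_real, Real.norm_eq_abs, abs_pow]

lemma abs_two_pi_sinc_le (x : ℝ) : |2 * Real.pi * Real.sinc (2 * Real.pi * x)| ≤ 2 * Real.pi := by
  rw [abs_mul, abs_of_pos (by positivity)]
  have := Real.abs_sinc_le_one (2 * Real.pi * x)
  nlinarith [Real.pi_pos]

lemma continuous_exampleFun (b : ℝ) : Continuous (exampleFun b) := by
  have := Real.continuous_sinc
  unfold exampleFun
  fun_prop

/-- Jordan's inequality `sin y ≥ 2 y / π` on `[0, π / 2]`, with `y = 2πx`. -/
lemma four_le_two_pi_sinc {x : ℝ} (hx : |x| ≤ 1 / 4) :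
    4 ≤ 2 * Real.pi * Real.sinc (2 * Real.pi * x) := by
  have hπ := Real.pi_pos
  have key : ∀ y : ℝ, 0 ≤ y → y ≤ 1 / 4 → 4 ≤ 2 * Real.pi * Real.sinc (2 * Real.pi * y) := by
    intro y hy0 hy
    rcases hy0.eq_or_lt with rfl | hy0
    · simp; linarith [Real.pi_gt_three]
    · have h1 := Real.mul_le_sin (x := 2 * Real.pi * y) (by positivity) (by nlinarith)
      rw [← two_pi_sinc_mul, show 2 / Real.pi * (2 * Real.pi * y) = 4 * y by field_simp; ring] at h1
      exact le_of_mul_le_mul_right h1 hy0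
  rcases abs_cases x with ⟨h, h'⟩ | ⟨h, h'⟩
  · exact key x h' (by linarith)
  · have := key (-x) (by linarith) (by linarith)
    rwa [mul_neg, Real.sinc_neg] at this

lemma norm_inv_one_add_sq (x : ℝ) : ‖(1 + x ^ 2)⁻¹‖ = (1 + x ^ 2)⁻¹ := by
  rw [Real.norm_eq_abs, abs_of_pos (by positivity)]

/-- The bound `π` holds for all `p` at once because the weight is at most `1` and its integral is
`π ≥ 1`. -/
lemma eLpNorm_inv_one_add_sq_le {p : ℝ≥0∞} (hp : 1 ≤ p) :
    eLpNorm (fun x : ℝ => (1 + x ^ 2)⁻¹) p volume ≤ ENNReal.ofReal Real.pi := by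
  have hle1 : ∀ x : ℝ, ‖(1 + x ^ 2)⁻¹‖ₑ ≤ 1 := fun x => by
    rw [← ofReal_norm, norm_inv_one_add_sq, ← ENNReal.ofReal_one]
    exact ENNReal.ofReal_le_ofReal (inv_le_one_of_one_le₀ (by nlinarith [sq_nonneg x]))
  have hπ1 : 1 ≤ ENNReal.ofReal Real.pi := by
    rw [← ENNReal.ofReal_one]; exact ENNReal.ofReal_le_ofReal (by linarith [Real.pi_gt_three])
  rcases eq_or_ne p ∞ with rfl | hp'
  · rw [eLpNorm_exponent_top, eLpNormEssSup_eq_essSup_enorm]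
    exact (essSup_le_of_ae_le _ (Filter.Eventually.of_forall hle1)).trans hπ1
  have hp0 : p ≠ 0 := (zero_lt_one.trans_le hp).ne'
  have hq1 : 1 ≤ p.toReal := by
    rw [← ENNReal.toReal_one]; exact (ENNReal.toReal_le_toReal (by simp) hp').2 hp
  rw [eLpNorm_eq_lintegral_rpow_enorm_toReal hp0 hp']
  have h1 : ∫⁻ x : ℝ, ‖(1 + x ^ 2)⁻¹‖ₑ ^ p.toReal ≤ ENNReal.ofReal Real.pi := by
    calc _ ≤ ∫⁻ x : ℝ, ‖(1 + x ^ 2)⁻¹‖ₑ := by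
          refine lintegral_mono fun x => ?_
          conv_rhs => rw [← ENNReal.rpow_one ‖(1 + x ^ 2)⁻¹‖ₑ]
          exact ENNReal.rpow_le_rpow_of_exponent_ge (hle1 x) hq1
      _ = ENNReal.ofReal Real.pi := by
          rw [← ofReal_integral_norm_eq_lintegral_enorm integrable_inv_one_add_sq]
          simp_rw [norm_inv_one_add_sq]
          rw [integral_univ_inv_one_add_sq]
  calc _ ≤ ENNReal.ofReal Real.pi ^ (1 / p.toReal) := by gcongr
    _ ≤ ENNReal.ofReal Real.pi ^ (1 : ℝ) :=
        ENNReal.rpow_le_rpow_of_exponent_le hπ1 (by rw [div_le_one (by linarith)]; exact hq1)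
    _ = _ := ENNReal.rpow_one _

lemma pow_le_mul_sq {u v : ℝ} (hu : 0 ≤ u) (huv : u ≤ v) {n : ℕ} (hn : 2 ≤ n) :
    u ^ n ≤ v ^ (n - 2) * u ^ 2 := by
  obtain ⟨m, rfl⟩ := Nat.exists_eq_add_of_le hn
  rw [add_comm, pow_add, Nat.add_sub_cancel]
  gcongr

lemma memLp_exampleFun {p : ℝ≥0∞} (hp : 1 ≤ p) {b : ℝ} (hn : 2 ≤ ⌊b / (4 * Real.pi)⌋₊) :
    MemLp (exampleFun b) p volume := by
  set n := ⌊b / (4 * Real.pi)⌋₊ with hn'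
  have hw : MemLp (fun x : ℝ => (1 + x ^ 2)⁻¹) p volume :=
    ⟨integrable_inv_one_add_sq.1, (eLpNorm_inv_one_add_sq_le hp).trans_lt ENNReal.ofReal_lt_top⟩
  refine (hw.const_mul ((2 * Real.pi) ^ (n - 2) * (4 * Real.pi ^ 2 + 1))).mono
    (continuous_exampleFun b).aestronglyMeasurable (Filter.Eventually.of_forall fun x => ?_)
  rw [norm_exampleFun, norm_mul, norm_inv_one_add_sq, Real.norm_eq_abs,
    abs_of_pos (show 0 < (2 * Real.pi) ^ (n - 2) * (4 * Real.pi ^ 2 + 1) by positivity),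
    mul_assoc (_ ^ (n - 2))]
  refine (pow_le_mul_sq (abs_nonneg _) (abs_two_pi_sinc_le x) hn).trans ?_
  refine mul_le_mul_of_nonneg_left ?_ (by positivity)
  rw [← div_eq_mul_inv, le_div_iff₀ (by positivity), sq_abs, mul_add, mul_one, ← mul_pow,
    two_pi_sinc_mul]
  have h1 := Real.sin_sq_le_one (2 * Real.pi * x)
  have h2 := pow_le_pow_left₀ (abs_nonneg _) (abs_two_pi_sinc_le x) 2
  rw [sq_abs] at h2
  nlinarith

lemma le_eLpNorm_exampleFun {p : ℝ≥0∞} (hp : 1 ≤ p) (b : ℝ) :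
    ENNReal.ofReal (4 ^ ⌊b / (4 * Real.pi)⌋₊ / 2) ≤ eLpNorm (exampleFun b) p volume := by
  set n := ⌊b / (4 * Real.pi)⌋₊ with hn'
  have hp0 : p ≠ 0 := (zero_lt_one.trans_le hp).ne'
  set μ := volume.restrict (Icc (-(1 / 4) : ℝ) (1 / 4)) with hμ
  have huniv : μ univ = ENNReal.ofReal (1 / 2) := by
    rw [hμ, Measure.restrict_apply_univ, Real.volume_Icc]; norm_num
  have hμ0 : μ ≠ 0 := by
    intro h
    rw [h] at huniv
    exact (ENNReal.ofReal_pos.2 (by norm_num : (0 : ℝ) < 1 / 2)).ne huniv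
  have h1 : eLpNorm (fun _ : ℝ => (4 ^ n : ℝ)) p μ ≤ eLpNorm (exampleFun b) p μ := by
    refine eLpNorm_mono_ae ?_
    filter_upwards [ae_restrict_mem measurableSet_Icc] with x hx
    rw [norm_exampleFun, Real.norm_eq_abs, abs_of_pos (by positivity)]
    have := four_le_two_pi_sinc (abs_le.2 hx)
    exact pow_le_pow_left₀ (by norm_num) (this.trans (le_abs_self _)) _
  refine le_trans ?_ (h1.trans (eLpNorm_restrict_le _ _ _ _))
  rw [eLpNorm_const _ hp0 hμ0, huniv, ← ofReal_norm, Real.norm_eq_abs, abs_of_pos (by positivity),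
    div_eq_mul_one_div, ENNReal.ofReal_mul (by positivity)]
  gcongr
  conv_lhs => rw [← ENNReal.rpow_one (ENNReal.ofReal (1 / 2))]
  refine ENNReal.rpow_le_rpow_of_exponent_ge ?_ ?_
  · rw [← ENNReal.ofReal_one]; exact ENNReal.ofReal_le_ofReal (by norm_num)
  · rcases eq_or_ne p ∞ with rfl | hp'
    · simp
    · have hq1 : 1 ≤ p.toReal := by
        rw [← ENNReal.toReal_one]; exact (ENNReal.toReal_le_toReal (by simp) hp').2 hp
      rw [div_le_one (by linarith)]; exact hq1

/-- On `E_γ` the quotient `|sin (2πx) / x|` is at most `4πγ · (4|x|)⁻¹`, with `4|x| ≥ 1`; all but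
two of the factors `(4|x|)⁻¹` are discarded and the remaining two give the weight
`1 / (1 + x²)`. The total constant `17 π / 8` lost in the comparison is absorbed by `3^n ≥ 9`. -/
lemma eLpNorm_exampleFun_restrict_le {p : ℝ≥0∞} (hp : 1 ≤ p) {b γ : ℝ} (hγ : 0 < γ)
    (hγ1 : γ ≤ 1 / 2) (hn : 2 ≤ ⌊b / (4 * Real.pi)⌋₊) :
    eLpNorm (exampleFun b) p (volume.restrict (exampleSet γ))
      ≤ ENNReal.ofReal ((3 * Real.pi * γ) ^ ⌊b / (4 * Real.pi)⌋₊) *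
        eLpNorm (exampleFun b) p volume := by
  set n := ⌊b / (4 * Real.pi)⌋₊ with hn'
  set w : ℝ → ℝ := fun x => (1 + x ^ 2)⁻¹ with hw
  have h1 : eLpNorm (exampleFun b) p (volume.restrict (exampleSet γ))
      ≤ eLpNorm (((4 * (Real.pi * γ)) ^ n * (17 / 16) : ℝ) • w) p (volume.restrict (exampleSet γ)) := by
    refine eLpNorm_mono_ae ?_
    filter_upwards [ae_restrict_mem (measurableSet_exampleSet γ)] with x hx
    have hx4 := quarter_le_abs_of_mem_exampleSet hγ1 hx
    have hx0 : 0 < |x| := by linarith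
    have hs := abs_sin_le_of_mem_exampleSet hx
    rw [← two_pi_sinc_mul, abs_mul] at hs
    set u := |2 * Real.pi * Real.sinc (2 * Real.pi * x)| with hu
    have hu1 : u ≤ 4 * (Real.pi * γ) * (4 * |x|)⁻¹ := by
      rw [← div_eq_mul_inv, le_div_iff₀ (by positivity)]
      linarith
    have hv1 : (4 * |x|)⁻¹ ≤ 1 := inv_le_one_of_one_le₀ (by linarith)
    have hv2 : ((4 * |x|)⁻¹) ^ 2 ≤ 17 / 16 * w x := by
      rw [inv_pow, hw, ← div_eq_mul_inv, inv_le_comm₀ (by positivity) (by positivity), inv_div,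
        div_le_iff₀ (by norm_num), mul_pow, sq_abs]
      have : (1 / 4) ^ 2 ≤ x ^ 2 := by
        rw [← sq_abs x]; exact pow_le_pow_left₀ (by norm_num) hx4 2
      nlinarith
    rw [norm_exampleFun, ← hu, Pi.smul_apply, smul_eq_mul, norm_mul, hw, norm_inv_one_add_sq,
      Real.norm_eq_abs, abs_of_pos (by positivity), mul_assoc]
    calc u ^ n ≤ (4 * (Real.pi * γ) * (4 * |x|)⁻¹) ^ n := pow_le_pow_left₀ (abs_nonneg _) hu1 n
      _ = (4 * (Real.pi * γ)) ^ n * ((4 * |x|)⁻¹) ^ n := mul_pow _ _ _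
      _ ≤ (4 * (Real.pi * γ)) ^ n * (1 ^ (n - 2) * ((4 * |x|)⁻¹) ^ 2) := by
          gcongr
          exact pow_le_mul_sq (by positivity) hv1 hn
      _ ≤ _ := by
          rw [one_pow, one_mul]
          gcongr
  have h2 : eLpNorm (exampleFun b) p (volume.restrict (exampleSet γ))
      ≤ ENNReal.ofReal ((4 * (Real.pi * γ)) ^ n * (17 / 16) * Real.pi) := by
    refine h1.trans ((eLpNorm_restrict_le _ _ _ _).trans ?_)
    rw [eLpNorm_const_smul, ENNReal.ofReal_mul (by positivity), ← ofReal_norm, Real.norm_eq_abs,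
      abs_of_pos (by positivity)]
    gcongr
    exact eLpNorm_inv_one_add_sq_le hp
  refine h2.trans (le_trans ?_ (mul_le_mul_right (le_eLpNorm_exampleFun hp b) _))
  rw [← hn', ← ENNReal.ofReal_mul (by positivity)]
  refine ENNReal.ofReal_le_ofReal ?_
  have e1 : (4 * (Real.pi * γ)) ^ n = (Real.pi * γ) ^ n * 4 ^ n := by rw [mul_comm, mul_pow]
  have e2 : (3 * Real.pi * γ) ^ n = 3 ^ n * (Real.pi * γ) ^ n := by rw [mul_assoc, mul_pow]
  have e3 : (9 : ℝ) ≤ 3 ^ n := by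
    calc (9 : ℝ) = 3 ^ 2 := by norm_num
      _ ≤ 3 ^ n := pow_le_pow_right₀ (by norm_num) hn
  rw [e1, e2]
  calc (Real.pi * γ) ^ n * 4 ^ n * (17 / 16) * Real.pi
      = (Real.pi * γ) ^ n * 4 ^ n * (17 / 16 * Real.pi) := by ring
    _ ≤ (Real.pi * γ) ^ n * 4 ^ n * (3 ^ n / 2) := by
        gcongr
        linarith [Real.pi_lt_four]
    _ = _ := by ring

end ExampleFun

section ExampleSpectrum

/-- `sin (2πx) / x` is a superposition of the characters with frequencies in `[-1, 1]`. -/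
lemma ofReal_two_pi_sinc_eq_integral (x : ℝ) :
    ((2 * Real.pi * Real.sinc (2 * Real.pi * x) : ℝ) : ℂ)
      = Real.pi * ∫ σ in (-1 : ℝ)..1, Complex.exp (((2 * Real.pi * (x * σ) : ℝ) : ℂ) * Complex.I) := by
  rcases eq_or_ne x 0 with rfl | hx
  · simp; ring
  · have hc : (2 * Real.pi * x * Complex.I : ℂ) ≠ 0 := by
      have := Real.pi_ne_zero
      simp [hx, this]
    have h1 : ∀ σ : ℝ, Complex.exp (((2 * Real.pi * (x * σ) : ℝ) : ℂ) * Complex.I)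
        = Complex.exp (2 * Real.pi * x * Complex.I * σ) := fun σ => by
      congr 1; push_cast; ring
    simp_rw [h1]
    rw [integral_exp_mul_complex hc]
    have h2 := two_pi_sinc_mul x
    have h3 : ((2 * Real.pi * Real.sinc (2 * Real.pi * x) : ℝ) : ℂ) * x
        = Complex.sin (2 * Real.pi * x) := by
      rw [← Complex.ofReal_mul, h2]; push_cast; rfl
    have hxc : (x : ℂ) ≠ 0 := by exact_mod_cast hx
    have hπ : (Real.pi : ℂ) ≠ 0 := by exact_mod_cast Real.pi_ne_zero
    have hI := Complex.I_ne_zero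
    refine mul_right_cancel₀ hxc ?_
    rw [h3, Complex.sin, Complex.ofReal_one, Complex.ofReal_neg, Complex.ofReal_one, mul_one,
      mul_neg, mul_one, neg_mul]
    field_simp
    rw [Complex.I_sq]
    ring

lemma fourier_compSubConst_apply (h : 𝓢(ℝ, ℂ)) (σ x : ℝ) :
    (𝓕 (SchwartzMap.compSubConstCLM ℂ (-σ) h) : 𝓢(ℝ, ℂ)) x
      = Complex.exp (((2 * Real.pi * (x * σ) : ℝ) : ℂ) * Complex.I) * (𝓕 h : 𝓢(ℝ, ℂ)) x := by
  rw [SchwartzMap.fourier_coe, SchwartzMap.fourier_coe, Real.fourier_real_eq_integral_exp_smul,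
    Real.fourier_real_eq_integral_exp_smul, ← integral_const_mul]
  rw [← integral_add_right_eq_self (fun v : ℝ => Complex.exp (((2 * Real.pi * (x * σ) : ℝ) : ℂ) *
    Complex.I) * (Complex.exp (((-2 * Real.pi * v * x : ℝ) : ℂ) * Complex.I) • h v)) σ]
  refine integral_congr_ae (Filter.Eventually.of_forall fun v => ?_)
  simp only [SchwartzMap.compSubConstCLM_apply, sub_neg_eq_add, smul_eq_mul]
  rw [← mul_assoc, ← Complex.exp_add]
  congr 2
  push_cast
  ring

/-- The `n`-th power of `sin (2πx) / x` is orthogonal to the Fourier transforms of the Schwartz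
functions vanishing on `[-n, n]`: each factor is a superposition of modulations by frequencies in
`[-1, 1]`. -/
lemma integral_fourier_mul_sinc_pow_eq_zero (n : ℕ) (h : 𝓢(ℝ, ℂ))
    (hh : ∀ ξ ∈ Icc (-n : ℝ) n, h ξ = 0) :
    ∫ x : ℝ, (𝓕 h : 𝓢(ℝ, ℂ)) x *
      ((2 * Real.pi * Real.sinc (2 * Real.pi * x) : ℝ) : ℂ) ^ n = 0 := by
  induction n generalizing h with
  | zero =>
    simp only [pow_zero, mul_one]
    have h1 : (𝓕⁻ (𝓕 h) : 𝓢(ℝ, ℂ)) 0 = h 0 := by rw [FourierTransform.fourierInv_fourier_eq]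
    rw [SchwartzMap.fourierInv_coe, Real.fourierInv_eq'] at h1
    simp only [inner_zero_right, mul_zero, Complex.ofReal_zero, zero_mul, Complex.exp_zero,
      one_smul] at h1
    rw [h1]
    exact hh 0 (by simp)
  | succ n ih =>
    set s : ℝ → ℂ := fun x => ((2 * Real.pi * Real.sinc (2 * Real.pi * x) : ℝ) : ℂ) with hs
    have hsc : Continuous s := by
      have := Real.continuous_sinc
      fun_prop
    have h1 : ∀ x, (𝓕 h : 𝓢(ℝ, ℂ)) x * s x ^ (n + 1) = Real.pi * ∫ σ in Ioc (-1 : ℝ) 1,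
        (𝓕 (SchwartzMap.compSubConstCLM ℂ (-σ) h) : 𝓢(ℝ, ℂ)) x * s x ^ n := by
      intro x
      simp_rw [fourier_compSubConst_apply]
      have h2 : s x = _ := ofReal_two_pi_sinc_eq_integral x
      rw [integral_mul_const, integral_mul_const, ← intervalIntegral.integral_of_le (by norm_num),
        pow_succ]
      linear_combination (𝓕 h : 𝓢(ℝ, ℂ)) x * s x ^ n * h2
    refine (integral_congr_ae (Filter.Eventually.of_forall h1)).trans ?_
    rw [integral_const_mul, integral_integral_swap]
    · rw [setIntegral_eq_zero_of_forall_eq_zero, mul_zero]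
      intro σ hσ
      refine ih _ fun ξ hξ => ?_
      rw [SchwartzMap.compSubConstCLM_apply, sub_neg_eq_add]
      refine hh _ ?_
      push_cast
      exact ⟨by linarith [hξ.1, hσ.1], by linarith [hξ.2, hσ.2]⟩
    · simp_rw [Function.uncurry_def, fourier_compSubConst_apply]
      have hi : Integrable fun x => (𝓕 h : 𝓢(ℝ, ℂ)) x * s x ^ n := by
        refine (𝓕 h : 𝓢(ℝ, ℂ)).integrable.mul_bdd (c := (2 * Real.pi) ^ n)
          (hsc.pow n).aestronglyMeasurable (Filter.Eventually.of_forall fun x => ?_)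
        rw [norm_pow, hs, Complex.norm_real]
        exact pow_le_pow_left₀ (abs_nonneg _) (abs_two_pi_sinc_le x) n
      have hone : Integrable (fun _ : ℝ => (1 : ℝ)) (volume.restrict (Ioc (-1 : ℝ) 1)) :=
        integrable_const _
      refine (hi.norm.mul_prod hone).mono' ?_ (Filter.Eventually.of_forall fun q => ?_)
      · refine Continuous.aestronglyMeasurable ?_
        have := (𝓕 h : 𝓢(ℝ, ℂ)).continuous
        fun_prop
      · rw [mul_assoc, norm_mul, Complex.norm_exp_ofReal_mul_I, one_mul, mul_one]

lemma fourierSupport_exampleFun_subset {p : ℝ≥0∞} [Fact (1 ≤ p)] {b : ℝ} (hb : 0 ≤ b)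
    (hf : MemLp (exampleFun b) p (volume : Measure ℝ)) :
    fourierSupport (hf.toLp (exampleFun b)) ⊆ Icc (-(b / 2)) (b / 2) := by
  set n := ⌊b / (4 * Real.pi)⌋₊ with hn
  have hnb : n * (4 * Real.pi) ≤ b := by
    rw [← le_div_iff₀ (by positivity)]; exact Nat.floor_le (by positivity)
  rintro _ ⟨ξ, hξ, rfl⟩
  have hξn : ξ ∈ Icc (-n : ℝ) n := by
    refine (Distribution.mem_dsupport_iff ξ).1 hξ _ (fun u hu => ?_) isClosed_Icc
    rw [TemperedDistribution.fourier_apply, Lp.toTemperedDistribution_apply,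
      ← integral_fourier_mul_sinc_pow_eq_zero n u fun ξ hξ => ?_]
    · refine integral_congr_ae ?_
      filter_upwards [hf.coeFn_toLp] with x hx
      rw [hx, smul_eq_mul, exampleFun, Complex.ofReal_pow]
    · exact image_eq_zero_of_notMem_tsupport fun h => hu h hξ
  have hπ := Real.pi_pos
  have h1 := hξn.1
  have h2 := hξn.2
  constructor
  · simp only; nlinarith
  · simp only; nlinarith

end ExampleSpectrum

/-- The extremal example, with the constant `1 / (3π)`. If `3πγ ≥ 1` the claimed factor is at least
`1` and there is nothing to prove; otherwise `γ ≤ 1 / 2`. -/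
theorem exists_sharpness_example :
    ∃ C : ℝ, 0 < C ∧ ∃ b₀ : ℝ,
      ∀ (p : ℝ≥0∞) [Fact (1 ≤ p)] (γ b : ℝ), 0 < γ → γ ≤ 1 → b₀ ≤ b →
        IsThick 1 γ (exampleSet γ) ∧
        ∃ hf : MemLp (exampleFun b) p (volume : Measure ℝ),
          fourierSupport (hf.toLp (exampleFun b)) ⊆ Icc (-(b / 2)) (b / 2) ∧
          0 < eLpNorm (exampleFun b) p volume ∧
          eLpNorm (exampleFun b) p (volume.restrict (exampleSet γ))
            ≤ ENNReal.ofReal ((γ / C) ^ (b / (4 * Real.pi) - 1))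
              * eLpNorm (exampleFun b) p volume := by
  have hπ := Real.pi_pos
  refine ⟨(3 * Real.pi)⁻¹, by positivity, 8 * Real.pi, fun p hp γ b hγ hγ1 hb => ?_⟩
  have hb2 : 2 ≤ b / (4 * Real.pi) := by rw [le_div_iff₀ (by positivity)]; linarith
  have hn : 2 ≤ ⌊b / (4 * Real.pi)⌋₊ := Nat.le_floor (by exact_mod_cast hb2)
  refine ⟨isThick_exampleSet hγ hγ1, memLp_exampleFun hp.out hn,
    fourierSupport_exampleFun_subset (by linarith) _, ?_, ?_⟩
  · exact lt_of_lt_of_le (ENNReal.ofReal_pos.2 (by positivity)) (le_eLpNorm_exampleFun hp.out b)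
  rw [div_inv_eq_mul, mul_comm γ]
  rcases le_or_gt 1 (3 * Real.pi * γ) with h | h
  · refine (eLpNorm_restrict_le _ _ _ _).trans ?_
    conv_lhs => rw [← one_mul (eLpNorm (exampleFun b) p volume)]
    gcongr
    rw [← ENNReal.ofReal_one]
    exact ENNReal.ofReal_le_ofReal (Real.one_le_rpow h (by linarith))
  · have hγ2 : γ ≤ 1 / 2 := by nlinarith [Real.pi_gt_three]
    refine (eLpNorm_exampleFun_restrict_le hp.out hγ hγ2 hn).trans ?_
    gcongr
    rw [← Real.rpow_natCast]
    refine Real.rpow_le_rpow_of_exponent_ge (by positivity) h.le ?_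
    linarith [Nat.lt_floor_add_one (b / (4 * Real.pi))]

theorem theorem1 :
    -- the inequality, with an absolute constant
    (∃ C : ℝ, 0 < C ∧
      ∀ (p : ℝ≥0∞) [Fact (1 ≤ p)] (a b c γ : ℝ) (E : Set ℝ) (f : Lp ℂ p (volume : Measure ℝ)),
        0 < a → 0 ≤ b → 0 < γ → IsThick a γ E → fourierSupport f ⊆ Icc c (c + b) →
        ENNReal.ofReal ((γ / C) ^ (C * (a * b + 1))) * eLpNorm f p volume
          ≤ eLpNorm f p (volume.restrict E)) ∧
    -- the example showing that it is sharp up to the constant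
    (∃ C : ℝ, 0 < C ∧ ∃ b₀ : ℝ,
      ∀ (p : ℝ≥0∞) [Fact (1 ≤ p)] (γ b : ℝ), 0 < γ → γ ≤ 1 → b₀ ≤ b →
        IsThick 1 γ (exampleSet γ) ∧
        ∃ hf : MemLp (exampleFun b) p (volume : Measure ℝ),
          fourierSupport (hf.toLp (exampleFun b)) ⊆ Icc (-(b / 2)) (b / 2) ∧
          0 < eLpNorm (exampleFun b) p volume ∧
          eLpNorm (exampleFun b) p (volume.restrict (exampleSet γ))
            ≤ ENNReal.ofReal ((γ / C) ^ (b / (4 * Real.pi) - 1))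
              * eLpNorm (exampleFun b) p volume) :=
  ⟨exists_logvinenko_sereda, exists_sharpness_example⟩
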